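/- **Setting.** A function $\mu:\mathbb N\to\mathbb R$ is *negligible* if $\lambda^k\mu(\lambda)\to 0$ as $\lambda\to\infty$ for every $k\in\mathbb N$. All registers consist of finitely many qubits, and $|0\rangle$ denotes the all-zero basis state of a register. A *state* is a density matrix (positive semidefinite, trace $1$), $A(\rho):=A\rho A^\dagger$ for an operator $A$, operators on some of the registers are tensored with the identity on the others, and $\|X\|_1=\operatorname{Tr}\sqrt{X^\dagger X}$. A *non-interactive quantum state commitment* (QSC) is given, for each security parameter $\lambda$, by a unitary $\mathsf{Com}$ on $n(\lambda)+\lambda$ qubits. Its input qubits are divided into a message register $M$ of $n(\lambda)$ qubits and a register $W$ of $\lambda$ qubits, and its output qubits are divided into a commitment register $C$ and a decommitment register $D$. No efficiency of $\mathsf{Com}$ is required. **Statistical swap binding.** For a challenge bit $b\in\{0,1\}$ and a computationally unbounded quantum adversary $A$, consider the following experiment. (1) $A$ prepares an arbitrary state on $(C,D,H)$, where $H$ is a private register of any finite number of qubits, and sends $(C,D)$ to the challenger. (2) The challenger applies $\mathsf{Com}^\dagger$ and measures $\{|0\rangle\langle 0|,\mathbb 1-|0\rangle\langle 0|\}$ on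 $W$; if the measurement rejects, the experiment outputs a uniformly random bit $b'$. (3) Otherwise, if $b=1$, the challenger replaces the contents of $M$ by $|0\rangle$ (it initializes a fresh register $E$ of the size of $M$ to $|0\rangle$ and applies $\mathsf{SWAP}[M,E]$). In both cases it then applies $\mathsf{Com}$ and sends $D$ to $A$. (4) $A$ performs an arbitrary two-outcome measurement on $(D,H)$, and its outcome $b'$ is the output of the experiment. The QSC is *statistically swap binding* if there is a negligible function $\mu$ such that for all such adversaries $A$ and all $\lambda$, the probability that $b'=b$ for uniformly random $b$ is at most $\tfrac12+\mu(\lambda)$. **Statistical extractability.** Let $M'$ be a register of the same size as $M$, and put $$\Pi=\mathsf{Com}\,(\mathbb 1_M\otimes|0\rangle\langle 0|_W)\,\mathsf{Com}^\dagger,\qquad \widehat{\mathsf{SWAP}}=\mathsf{Com}\;\mathsf{SWAP}[M,M']\;\mathsf{Com}^\dagger .$$ The QSC is *statistically extractable* if for each $\lambda$ there is a completely positive trace-preserving map $\mathsf{Ext}$ from operators on $(C,M')$ to operators on $(C,M')$, and there is a negligible function $\mu$, such that for all $\lambda$, all registers $H$ of finitely many qubits, all states $\rho$ on $(C,D,H)$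 and all unitaries $U$ on $(D,H)$, $$\Big\|\big(\Pi\circ U\circ \mathsf{Ext}\big)\big(\rho\otimes|0\rangle\langle 0|_{M'}\big)-\big(\widehat{\mathsf{SWAP}}\circ\Pi\circ U\big)\big(\rho\otimes|0\rangle\langle 0|_{M'}\big)\Big\|_1\le\mu(\lambda).$$ **Theorem.** A non-interactive quantum state commitment is statistically swap binding if and only if it is statistically extractable. -/

import Mathlib

open scoped Kronecker Matrix ComplexOrder

noncomputable section

namespace QuantumCommitment

/-- The computational basis of a register of `k` qubits. -/
abbrev Qubits (k : ℕ) : Type := Fin k → Bool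

/-- Operators on the finite-dimensional Hilbert space with orthonormal basis `ι`. The tensor product
of the spaces with bases `ι` and `κ` is the space with basis `ι × κ`. -/
abbrev Op (ι : Type) : Type := Matrix ι ι ℂ

/-- The projector `|0…0⟩⟨0…0|` on a register of `k` qubits. -/
def ketbraZero (k : ℕ) : Op (Qubits k) :=
  Matrix.single (fun _ => false) (fun _ => false) 1

/-- `A(ρ) = A ρ A†`. -/
def conj {ι κ : Type} [Fintype ι] (A : Matrix κ ι ℂ) (ρ : Op ι) : Op κ := A * ρ * Aᴴ

/-- Density matrices. -/
def IsDensity {ι : Type} [Fintype ι] (ρ : Op ι) : Prop := ρ.PosSemidef ∧ ρ.trace = 1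

/-- The partial trace over the first tensor factor. -/
def traceFst {ι κ : Type} [Fintype ι] (ρ : Op (ι × κ)) : Op κ :=
  Matrix.of fun x y => ∑ i, ρ (i, x) (i, y)

/-- The partial trace over the second tensor factor. -/
def traceSnd {ι κ : Type} [Fintype κ] (ρ : Op (ι × κ)) : Op ι :=
  Matrix.of fun x y => ∑ k, ρ (x, k) (y, k)

/-- The Schatten 1-norm `‖A‖₁ = Tr √(A†A)`: the sum of the singular values of `A`. -/
def traceNorm {ι : Type} [Fintype ι] [DecidableEq ι] (A : Op ι) : ℝ :=
  ∑ i, √((Matrix.isHermitian_conjTranspose_mul_self A).eigenvalues i)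

/-- The map `Φ ⊗ 𝟙` on operators on the space with basis `ι × α`, where `𝟙` is the identity map on
operators on the space with basis `α`. -/
def ampliate {ι κ : Type} (Φ : Op ι →ₗ[ℂ] Op κ) (α : Type) (ρ : Op (ι × α)) : Op (κ × α) :=
  Matrix.of fun x y => Φ (Matrix.of fun i j => ρ (i, x.2) (j, y.2)) x.1 y.1

/-- Completely positive trace-preserving maps. -/
structure IsCPTP {ι κ : Type} [Fintype ι] [Fintype κ] (Φ : Op ι →ₗ[ℂ] Op κ) : Prop where
  completelyPositive : ∀ (k : ℕ) (ρ : Op (ι × Fin k)),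
    ρ.PosSemidef → (ampliate Φ (Fin k) ρ).PosSemidef
  tracePreserving : ∀ ρ : Op ι, (Φ ρ).trace = ρ.trace

/-- Negligible functions of the security parameter. -/
def Negligible (μ : ℕ → ℝ) : Prop :=
  Asymptotics.SuperpolynomialDecay Filter.atTop (fun s : ℕ => (s : ℝ)) μ

/-- A non-interactive quantum state commitment. For each security parameter `s`, it consists of a
unitary on `n s + s` qubits, whose input qubits are divided into a message register `M` (`n s`
qubits) and a register `W` (`s` qubits), and whose output qubits are divided into a commitment
register `C` (`c s` qubits) and a decommitment register `D` (`d s` qubits). -/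
structure QSC where
  n : ℕ → ℕ
  c : ℕ → ℕ
  d : ℕ → ℕ
  size_eq : ∀ s, c s + d s = n s + s
  com : ∀ s, Matrix (Qubits (c s) × Qubits (d s)) (Qubits (n s) × Qubits s) ℂ
  com_isometry : ∀ s, (com s)ᴴ * com s = 1
  com_coisometry : ∀ s, com s * (com s)ᴴ = 1

namespace QSC

variable (S : QSC) (s : ℕ)

/-- The basis of the message register `M` (also used for its copies `M'` and `E`). -/
abbrev M : Type := Qubits (S.n s)

/-- The basis of the register `W`. -/
abbrev W (_S : QSC) (s : ℕ) : Type := Qubits s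

/-- The basis of the commitment register `C`. -/
abbrev C : Type := Qubits (S.c s)

/-- The basis of the decommitment register `D`. -/
abbrev D : Type := Qubits (S.d s)

/-- `Com`, from the registers `(M, W, H, M')` to the registers `(C, D, H, M')`, where `H` has
`h` qubits and `M'` has the size of `M`. -/
def comFull (h : ℕ) :
    Matrix (((S.C s × S.D s) × Qubits h) × S.M s) (((S.M s × S.W s) × Qubits h) × S.M s) ℂ :=
  (S.com s ⊗ₖ (1 : Op (Qubits h))) ⊗ₖ (1 : Op (S.M s))

/-- `SWAP[M, M']` on the registers `(M, W, H, M')`: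
it maps the basis vector `|m⟩ |w⟩ |x⟩ |m'⟩` to `|m'⟩ |w⟩ |x⟩ |m⟩`. -/
def swap (h : ℕ) : Op (((S.M s × S.W s) × Qubits h) × S.M s) :=
  Matrix.of fun out inp => if out = (((inp.2, inp.1.1.2), inp.1.2), inp.1.1.1) then 1 else 0

/-! ### Statistical swap binding -/

/-- An (unbounded, interactive) adversary in the swap binding experiment with security parameter
`s`. It keeps a private register `H` of `h` qubits, prepares a joint state of `(C, D, H)`, sends
`(C, D)` to the challenger, gets `D` back, and finally obtains its guess by a two-outcome
measurement (a POVM) on `(D, H)`. -/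
structure Adversary where
  h : ℕ
  state : Op ((S.C s × S.D s) × Qubits h)
  state_isDensity : IsDensity state
  povm : Bool → Op (S.D s × Qubits h)
  povm_posSemidef : ∀ b, (povm b).PosSemidef
  povm_sum : povm false + povm true = 1

variable {S s}

/-- The challenger applies `Com†` and measures whether `W` is `|0⟩`: the unnormalized state of
`(M, W, H)` after acceptance, whose trace is the probability of acceptance. -/
def acceptedState (A : S.Adversary s) : Op ((S.M s × S.W s) × Qubits A.h) :=
  conj (((1 : Op (S.M s)) ⊗ₖ ketbraZero s) ⊗ₖ (1 : Op (Qubits A.h)))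
    (conj ((S.com s)ᴴ ⊗ₖ (1 : Op (Qubits A.h))) A.state)

/-- The challenger's response. It initializes a fresh register `E` to `|0⟩`, applies `SWAP[M, E]`
if `b = 1` and does nothing if `b = 0`, then applies `Com` and sends `D`. The value is the
unnormalized state of the adversary's registers `(D, H)` (with `E` and `C` traced out). -/
def responseState (A : S.Adversary s) (b : Bool) : Op (S.D s × Qubits A.h) :=
  let σ := acceptedState A ⊗ₖ ketbraZero (S.n s)
  let σ' := if b then conj (S.swap s A.h) σ else σ
  traceFst (Matrix.reindex (Equiv.prodAssoc _ _ _) (Equiv.prodAssoc _ _ _)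
    (traceSnd (conj (S.comFull s A.h) σ')))

/-- The probability that the experiment with challenge bit `b` outputs `b'`. If the challenger
rejects, the output is a uniformly random bit. -/
def outputProb (A : S.Adversary s) (b b' : Bool) : ℝ :=
  (1 - (acceptedState A).trace.re) * (1 / 2) + (A.povm b' * responseState A b).trace.re

/-- The probability that the output equals the uniformly random challenge bit. -/
def winProb (A : S.Adversary s) : ℝ :=
  (outputProb A false false + outputProb A true true) / 2

variable (S s)

/-- Statistical swap binding. -/
def StatisticallySwapBinding : Prop :=
  ∃ μ : ℕ → ℝ, Negligible μ ∧ ∀ A : (∀ s, S.Adversary s), ∀ s, winProb (A s) ≤ 1 / 2 + μ s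

/-! ### Statistical extractability

The registers are ordered as `(C, D, H, M')`. -/

/-- `Π = Com (𝟙_M ⊗ |0⟩⟨0|_W) Com†`, tensored with the identity on `(H, M')`. -/
def validProj (h : ℕ) : Op (((S.C s × S.D s) × Qubits h) × S.M s) :=
  (conj (S.com s) ((1 : Op (S.M s)) ⊗ₖ ketbraZero s) ⊗ₖ (1 : Op (Qubits h))) ⊗ₖ (1 : Op (S.M s))

/-- `Com SWAP[M, M'] Com†`. -/
def swapHat (h : ℕ) : Op (((S.C s × S.D s) × Qubits h) × S.M s) :=
  conj (S.comFull s h) (S.swap s h)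

/-- An operator `U` on `(D, H)`, tensored with the identity on `(C, M')`. -/
def onDH {h : ℕ} (U : Op (S.D s × Qubits h)) : Op (((S.C s × S.D s) × Qubits h) × S.M s) :=
  Matrix.reindex (Equiv.prodAssoc _ _ _).symm (Equiv.prodAssoc _ _ _).symm
    ((1 : Op (S.C s)) ⊗ₖ U) ⊗ₖ (1 : Op (S.M s))

/-- The reordering of `(C, D, H, M')` as `(C, M', D, H)`. -/
def regroup (h : ℕ) :
    (((S.C s × S.D s) × Qubits h) × S.M s) ≃ ((S.C s × S.M s) × (S.D s × Qubits h)) where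
  toFun x := ((x.1.1.1, x.2), (x.1.1.2, x.1.2))
  invFun y := (((y.1.1, y.2.1), y.2.2), y.1.2)
  left_inv _ := rfl
  right_inv _ := rfl

variable {S s}

/-- A map on operators on `(C, M')`, tensored with the identity map on operators on `(D, H)`. -/
def onCM (Ext : Op (S.C s × S.M s) →ₗ[ℂ] Op (S.C s × S.M s)) {h : ℕ}
    (ρ : Op (((S.C s × S.D s) × Qubits h) × S.M s)) :
    Op (((S.C s × S.D s) × Qubits h) × S.M s) :=
  Matrix.reindex (S.regroup s h).symm (S.regroup s h).symm
    (ampliate Ext (S.D s × Qubits h) (Matrix.reindex (S.regroup s h) (S.regroup s h) ρ))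

variable (S)

/-- Statistical extractability. -/
def StatisticallyExtractable : Prop :=
  ∃ Ext : ∀ s, Op (S.C s × S.M s) →ₗ[ℂ] Op (S.C s × S.M s), (∀ s, IsCPTP (Ext s)) ∧
    ∃ μ : ℕ → ℝ, Negligible μ ∧
      ∀ (s h : ℕ) (ρ : Op ((S.C s × S.D s) × Qubits h)) (U : Op (S.D s × Qubits h)),
        IsDensity ρ → U ∈ Matrix.unitaryGroup (S.D s × Qubits h) ℂ →
          traceNorm
            (conj (S.validProj s h) (conj (S.onDH s U) (onCM (Ext s) (ρ ⊗ₖ ketbraZero (S.n s)))) -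
              conj (S.swapHat s h) (conj (S.validProj s h) (conj (S.onDH s U)
                (ρ ⊗ₖ ketbraZero (S.n s))))) ≤ μ s

end QSC

end QuantumCommitment

end

/-! Swap binding implies extractability. Let F be the isometry `encodeCM`, which encodes M with W =
|0⟩ and carries M' along, and let G be F preceded by the swap of M and M'. A binding adversary can
purify any input of F, so binding says that the state on (D,H) hardly depends on the message: both F
and G leave (D,H) close to what an encoded |0⟩ would leave, with the same state on H. Uhlmann's
theorem then yields, for each input, a contraction on the discarded registers (C,M') that takes F
nearly to G. Sion's minimax theorem makes the contraction independent of the input, and writing it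
as a mean of two unitaries replaces it by a unitary U with ‖(U ⊗ 1)F − G‖ ≤ 2√(4μ)
(`exists_unitary_of_marginals_close`, `exists_approximate_swap`). Conjugation by U is the extractor:
U agrees approximately with the encoded swap on the code space, it commutes with everything on
(D,H), and taking adjoints moves the projector Π to the other side (`traceNorm_extract_le`).

Extractability implies swap binding. Condition on acceptance. The extractor acts on (C,M'), so it
cannot change the statistics of a measurement on (D,H). After it, Π accepts almost surely, because
the swapped state that it approximates has trace one. By gentle measurement Π hardly disturbs the
statistics, and the result is close to the swapped state. Hence (D,H) looks nearly the same for both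
challenge bits (`winProb_le_of_extract`). Both losses are of square-root order, which preserves
negligibility. -/

section

set_option linter.unusedSectionVars false

open scoped Matrix.Norms.L2Operator MatrixOrder

/-! ### Matrix analysis: Gram matrices, polar decomposition, contractions, Powers–Størmer. -/

namespace Matrix

variable {ι κ κ' : Type*} [Fintype ι] [DecidableEq ι] [Fintype κ] [DecidableEq κ] [Fintype κ']
  [DecidableEq κ']

theorem PosSemidef.exists_eq_conjTranspose_mul_self {A : Matrix ι ι ℂ} (hA : A.PosSemidef) :
    ∃ R : Matrix ι ι ℂ, R.PosSemidef ∧ A = Rᴴ * R := by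
  refine ⟨CFC.sqrt A, (nonneg_iff_posSemidef.1 (CFC.sqrt_nonneg A)), ?_⟩
  rw [(nonneg_iff_posSemidef.1 (CFC.sqrt_nonneg A)).isHermitian.eq,
    CFC.sqrt_mul_sqrt_self A hA.nonneg]

theorem PosSemidef.trace_mul_nonneg {A B : Matrix ι ι ℂ} (hA : A.PosSemidef)
    (hB : B.PosSemidef) : 0 ≤ (A * B).trace := by
  obtain ⟨R, -, rfl⟩ := hA.exists_eq_conjTranspose_mul_self
  rw [Matrix.mul_assoc, trace_mul_comm]
  exact (hB.mul_mul_conjTranspose_same R).trace_nonneg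

theorem norm_toLp_sq_eq_re (x : ι → ℂ) : ‖WithLp.toLp 2 x‖ ^ 2 = (star x ⬝ᵥ x).re := by
  rw [← inner_self_eq_norm_sq (𝕜 := ℂ), EuclideanSpace.inner_eq_star_dotProduct, dotProduct_comm]
  rfl

theorem norm_toLp_mulVec_le (A : Matrix κ ι ℂ) (x : ι → ℂ) :
    ‖WithLp.toLp 2 (A *ᵥ x)‖ ≤ ‖A‖ * ‖WithLp.toLp 2 x‖ :=
  A.l2_opNorm_mulVec (WithLp.toLp 2 x)

theorem norm_le_of_norm_toLp_mulVec_le (A : Matrix κ ι ℂ) {c : ℝ} (hc : 0 ≤ c)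
    (h : ∀ x, ‖WithLp.toLp 2 (A *ᵥ x)‖ ≤ c * ‖WithLp.toLp 2 x‖) : ‖A‖ ≤ c := by
  rw [l2_opNorm_def]
  exact ContinuousLinearMap.opNorm_le_bound _ hc fun x => h x.ofLp

/-- Matrices with the same Gram matrix differ by a unitary. -/
theorem exists_mem_unitaryGroup_mul_eq {A B : Matrix κ ι ℂ} (h : Aᴴ * A = Bᴴ * B) :
    ∃ U ∈ unitaryGroup κ ℂ, U * B = A := by
  set a := toEuclideanLin A
  set b := toEuclideanLin B
  have hn : ∀ x, ‖a x‖ = ‖b x‖ := by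
    intro x
    have key : ∀ C : Matrix κ ι ℂ, ‖toEuclideanLin C x‖ ^ 2 =
        (star x.ofLp ⬝ᵥ ((Cᴴ * C) *ᵥ x.ofLp)).re := by
      intro C
      have := norm_toLp_sq_eq_re (C *ᵥ x.ofLp)
      rw [star_mulVec, ← dotProduct_mulVec, mulVec_mulVec] at this
      exact this
    have : ‖a x‖ ^ 2 = ‖b x‖ ^ 2 := by rw [key A, key B, h]
    exact (sq_eq_sq₀ (norm_nonneg _) (norm_nonneg _)).1 this
  have hker : LinearMap.ker b ≤ LinearMap.ker a := by
    intro x hx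
    rw [LinearMap.mem_ker] at hx ⊢
    rw [← norm_eq_zero, hn, hx, norm_zero]
  -- The assignment B x ↦ A x is well defined and isometric on the range of B; in finite dimension
  -- it extends to an isometry of the whole space.
  let L₀ : LinearMap.range b →ₗ[ℂ] EuclideanSpace ℂ κ :=
    ((LinearMap.ker b).liftQ a hker).comp b.quotKerEquivRange.symm.toLinearMap
  have hL₀ : ∀ x, L₀ ⟨b x, LinearMap.mem_range_self b x⟩ = a x := by
    intro x
    have : b.quotKerEquivRange.symm ⟨b x, LinearMap.mem_range_self b x⟩
        = (LinearMap.ker b).mkQ x := by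
      rw [LinearEquiv.symm_apply_eq]
      rfl
    simp [L₀, this]
  let L : LinearMap.range b →ₗᵢ[ℂ] EuclideanSpace ℂ κ :=
    ⟨L₀, by rintro ⟨_, x, rfl⟩; rw [hL₀]; exact hn x⟩
  set U : Matrix κ κ ℂ := toEuclideanLin.symm L.extend.toLinearMap
  have hU : ∀ y : EuclideanSpace ℂ κ, toEuclideanLin U y = L.extend y := by
    intro y; simp [U]
  refine ⟨U, ?_, ?_⟩
  · rw [mem_unitaryGroup_iff', star_eq_conjTranspose]
    apply toEuclideanLin.injective
    ext1 y
    refine ext_inner_left ℂ fun z => ?_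
    have h1 : toEuclideanLin (Uᴴ * U) y = toEuclideanLin Uᴴ (toEuclideanLin U y) := by
      simp [toLpLin_apply, mulVec_mulVec]
    rw [h1, toEuclideanLin_conjTranspose_eq_adjoint, LinearMap.adjoint_inner_right, hU, hU,
      L.extend.inner_map_map]
    simp
  · apply toEuclideanLin.injective
    ext1 y
    have h1 : toEuclideanLin (U * B) y = toEuclideanLin U (toEuclideanLin B y) := by
      simp [toLpLin_apply, mulVec_mulVec]
    rw [h1, hU]
    have := L.extend_apply ⟨b y, LinearMap.mem_range_self b y⟩
    exact this.trans (hL₀ y)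

theorem norm_le_one_of_posSemidef {W : Matrix κ ι ℂ} (h : (1 - Wᴴ * W).PosSemidef) : ‖W‖ ≤ 1 := by
  have h1 : ‖Wᴴ * W‖ ≤ 1 :=
    (CStarAlgebra.norm_le_one_iff_of_nonneg _
      (posSemidef_conjTranspose_mul_self W).nonneg).2 h
  rw [l2_opNorm_conjTranspose_mul_self] at h1
  nlinarith [norm_nonneg W]

/-- Matrices with the same Gram matrix are related by a contraction and its adjoint. -/
theorem exists_norm_le_one_mul_eq {A : Matrix κ ι ℂ} {B : Matrix κ' ι ℂ} (h : Aᴴ * A = Bᴴ * B) :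
    ∃ W : Matrix κ κ' ℂ, ‖W‖ ≤ 1 ∧ W * B = A ∧ Wᴴ * A = B := by
  -- Padding with zero rows gives A and B the common codomain κ ⊕ κ'. The upper right block of the
  -- resulting unitary is the contraction sought.
  obtain ⟨U, hU, hUB⟩ := exists_mem_unitaryGroup_mul_eq
    (A := fromRows A (0 : Matrix κ' ι ℂ)) (B := fromRows (0 : Matrix κ ι ℂ) B) (by
      simp [conjTranspose_fromRows_eq_fromCols_conjTranspose, fromCols_mul_fromRows, h])
  have hU1 : Uᴴ * U = 1 := mem_unitaryGroup_iff'.1 hU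
  have hUA : Uᴴ * fromRows A (0 : Matrix κ' ι ℂ) = fromRows (0 : Matrix κ ι ℂ) B := by
    rw [← hUB, ← Matrix.mul_assoc, hU1, Matrix.one_mul]
  obtain ⟨a, b, c, d, rfl⟩ : ∃ a b c d, U = fromBlocks a b c d :=
    ⟨_, _, _, _, (fromBlocks_toBlocks U).symm⟩
  rw [fromBlocks_conjTranspose, fromBlocks_multiply, ← fromBlocks_one, fromBlocks_inj] at hU1
  rw [fromBlocks_conjTranspose, fromBlocks_mul_fromRows] at hUA
  rw [fromBlocks_mul_fromRows] at hUB
  refine ⟨b, ?_, ?_, ?_⟩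
  · apply norm_le_one_of_posSemidef
    rw [← hU1.2.2.2, add_sub_cancel_left]
    exact posSemidef_conjTranspose_mul_self d
  · simpa using congrArg toRows₁ hUB
  · simpa using congrArg toRows₂ hUA

/-- Unitary polar decomposition. -/
theorem exists_polar (A : Matrix κ κ ℂ) :
    ∃ U ∈ unitaryGroup κ ℂ, ∃ P : Matrix κ κ ℂ, P.PosSemidef ∧ A = U * P ∧ Aᴴ * A = Pᴴ * P := by
  obtain ⟨P, hP, hA⟩ := (posSemidef_conjTranspose_mul_self A).exists_eq_conjTranspose_mul_self
  obtain ⟨U, hU, h⟩ := exists_mem_unitaryGroup_mul_eq hA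
  exact ⟨U, hU, P, hP, h.symm, hA⟩

/-- A contraction is the mean of two unitaries. -/
theorem exists_mem_unitaryGroup_add_eq {Y : Matrix κ κ ℂ} (hY : ‖Y‖ ≤ 1) :
    ∃ U ∈ unitaryGroup κ ℂ, ∃ V ∈ unitaryGroup κ ℂ, U + V = (2 : ℂ) • Y := by
  obtain ⟨U, hU, P, hP, rfl, h⟩ := exists_polar Y
  have hn : ‖P‖ ≤ 1 := by
    have := congrArg norm h
    rw [l2_opNorm_conjTranspose_mul_self, l2_opNorm_conjTranspose_mul_self] at this
    nlinarith [norm_nonneg P, norm_nonneg (U * P)]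
  -- The two unitaries are U(P ± i√(1 − P²)).
  let p : selfAdjoint (Matrix κ κ ℂ) := ⟨P, hP.isHermitian⟩
  have hp : ‖p‖ ≤ 1 := hn
  refine ⟨U * selfAdjoint.unitarySelfAddISMul p hp, ?_,
    U * (star (selfAdjoint.unitarySelfAddISMul p hp) : unitary _), ?_, ?_⟩
  · exact mul_mem hU (selfAdjoint.unitarySelfAddISMul p hp).2
  · exact mul_mem hU (star (selfAdjoint.unitarySelfAddISMul p hp)).2
  · rw [Unitary.coe_star, selfAdjoint.star_coe_unitarySelfAddISMul]
    simp only [selfAdjoint.unitarySelfAddISMul_coe, ← Matrix.mul_add]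
    rw [add_add_sub_cancel, two_smul, Matrix.mul_add]

/-- Write ρ as a sum of rank-one terms r rᴴ, with r running over the columns of Rᴴ, and apply
Cauchy–Schwarz to each ⟨r, Z r⟩. -/
theorem norm_trace_mul_le (Z : Matrix ι ι ℂ) {ρ : Matrix ι ι ℂ} (hρ : ρ.PosSemidef) :
    ‖(Z * ρ).trace‖ ≤ ‖Z‖ * ρ.trace.re := by
  obtain ⟨R, -, rfl⟩ := hρ.exists_eq_conjTranspose_mul_self
  let r : ι → ι → ℂ := fun i j => Rᴴ j i
  have e1 : (Z * (Rᴴ * R)).trace = ∑ i, star (r i) ⬝ᵥ (Z *ᵥ r i) := by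
    rw [← Matrix.mul_assoc, trace_mul_comm]
    simp only [trace, diag_apply]
    refine Finset.sum_congr rfl fun i _ => ?_
    rw [mul_apply']
    congr 1
    ext j
    simp [r]
  have e2 : (Rᴴ * R).trace = ∑ i, star (r i) ⬝ᵥ r i := by
    rw [trace_mul_comm]
    simp only [trace, diag_apply]
    refine Finset.sum_congr rfl fun i _ => ?_
    rw [mul_apply']
    congr 1
    ext j
    simp [r]
  rw [e1, e2, Complex.re_sum, Finset.mul_sum]
  refine (norm_sum_le _ _).trans (Finset.sum_le_sum fun i _ => ?_)
  rw [← norm_toLp_sq_eq_re]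
  have := norm_inner_le_norm (𝕜 := ℂ) (WithLp.toLp 2 (r i)) (WithLp.toLp 2 (Z *ᵥ r i))
  rw [EuclideanSpace.inner_eq_star_dotProduct, dotProduct_comm] at this
  refine this.trans ?_
  nlinarith [norm_toLp_mulVec_le Z (r i), norm_nonneg (WithLp.toLp 2 (r i))]

/-- A variant of the Powers–Størmer inequality. -/
theorem PosSemidef.exists_trace_sq_sub_le {P Q : Matrix ι ι ℂ} (hP : P.PosSemidef)
    (hQ : Q.PosSemidef) : ∃ E : Matrix ι ι ℂ, E.PosSemidef ∧ (1 - E).PosSemidef ∧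
      ((P - Q) * (P - Q)).trace.re ≤ (((2 : ℂ) • E - 1) * (P * P - Q * Q)).trace.re := by
  have hΔ : (P - Q).IsHermitian := hP.isHermitian.sub hQ.isHermitian
  -- E is the spectral projector of P − Q onto its nonnegative eigenvalues.
  obtain ⟨E, hE, hE', h1, h2, hc⟩ : ∃ E : Matrix ι ι ℂ, E.PosSemidef ∧ (1 - E).PosSemidef ∧
      (E * (P - Q)).PosSemidef ∧ ((1 - E) * (Q - P)).PosSemidef ∧ E * (P - Q) = (P - Q) * E := by
    set u := hΔ.eigenvectorUnitary
    set φ := Unitary.conjStarAlgAut ℂ _ u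
    have hφ : ∀ d : ι → ℝ, (∀ i, 0 ≤ d i) → (φ (diagonal fun i => (d i : ℂ))).PosSemidef := by
      intro d hd
      rw [Unitary.conjStarAlgAut_apply]
      refine (PosSemidef.diagonal (fun i => ?_)).mul_mul_conjTranspose_same _
      simpa using hd i
    have hs : P - Q = φ (diagonal fun i => (hΔ.eigenvalues i : ℂ)) := hΔ.spectral_theorem
    set l := hΔ.eigenvalues
    let e : ι → ℝ := fun i => if 0 ≤ l i then 1 else 0
    refine ⟨φ (diagonal fun i => (e i : ℂ)), hφ _ fun i => ?_, ?_, ?_, ?_, ?_⟩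
    · simp only [e]; split_ifs <;> norm_num
    · convert hφ (fun i => 1 - e i) fun i => ?_ using 1
      · rw [← map_one φ, ← map_sub, ← diagonal_one, diagonal_sub]; simp
      · simp only [e]; split_ifs <;> norm_num
    · convert hφ (fun i => e i * l i) fun i => ?_ using 1
      · rw [hs, ← map_mul, diagonal_mul_diagonal]; simp
      · simp only [e]; split_ifs <;> simp [*]
    · convert hφ (fun i => (1 - e i) * (- l i)) fun i => ?_ using 1
      · rw [← neg_sub P Q, hs, ← map_one φ, ← map_neg, ← map_sub, ← map_mul, ← diagonal_one,
          diagonal_sub, diagonal_neg, diagonal_mul_diagonal]; simp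
      · simp only [e]; split_ifs with h <;> simp
        exact (not_le.1 h).le
    · rw [hs, ← map_mul, ← map_mul, diagonal_mul_diagonal, diagonal_mul_diagonal]
      simp [mul_comm]
  refine ⟨E, hE, hE', ?_⟩
  -- The right side minus the left side of the claim is exactly 2 tr(E(P − Q)Q) + 2 tr((1 − E)(Q −
  -- P)P), since E commutes with P − Q.
  have n1 := (Complex.le_def.1 (h1.trace_mul_nonneg hQ)).1
  have n2 := (Complex.le_def.1 (h2.trace_mul_nonneg hP)).1
  have c1 : (E * (P * Q)).trace = (E * (Q * P)).trace := by
    have : (E * (P - Q) * P).trace = ((P - Q) * E * P).trace := by rw [hc]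
    rw [Matrix.mul_assoc, Matrix.mul_assoc, trace_mul_comm (P - Q), Matrix.mul_assoc] at this
    simp only [Matrix.sub_mul, Matrix.mul_sub, trace_sub] at this
    linear_combination this
  have c2 : (P * Q).trace = (Q * P).trace := trace_mul_comm _ _
  have c1' := congrArg Complex.re c1
  have c2' := congrArg Complex.re c2
  simp only [Matrix.sub_mul, Matrix.mul_sub, trace_sub, Matrix.one_mul, smul_mul, trace_smul,
    Complex.sub_re, smul_eq_mul, Matrix.mul_assoc, Complex.mul_re, Complex.re_ofNat,
    Complex.im_ofNat, Complex.zero_re] at *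
  linarith

end Matrix

/-! ### Duality between trace norm and operator norm. -/

namespace QuantumCommitment

open Matrix

variable {ι : Type} [Fintype ι] [DecidableEq ι]

/-- Links the eigenvalue formula for `traceNorm` to the polar factor P = √(XᴴX), so that the norm
becomes a trace against a unitary. -/
theorem exists_polar_traceNorm (X : Op ι) : ∃ U ∈ unitaryGroup ι ℂ, ∃ P : Op ι, P.PosSemidef ∧
    X = U * P ∧ P.trace = traceNorm X := by
  set hX := isHermitian_conjTranspose_mul_self X
  set φ := Unitary.conjStarAlgAut ℂ _ hX.eigenvectorUnitary
  set P := φ (diagonal fun i => ((√(hX.eigenvalues i) : ℝ) : ℂ)) with hPdef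
  have hP : P.PosSemidef := by
    rw [hPdef, Unitary.conjStarAlgAut_apply]
    refine (PosSemidef.diagonal (fun i => ?_)).mul_mul_conjTranspose_same _
    simp
  have hPP : Xᴴ * X = Pᴴ * P := by
    rw [hP.isHermitian.eq, hPdef, ← map_mul, diagonal_mul_diagonal]
    refine hX.spectral_theorem.trans ?_
    congr 2
    ext i
    simp only [Function.comp_apply, ← Complex.ofReal_mul]
    rw [Real.mul_self_sqrt (eigenvalues_conjTranspose_mul_self_nonneg X i)]
    rfl
  obtain ⟨U, hU, h⟩ := exists_mem_unitaryGroup_mul_eq hPP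
  refine ⟨U, hU, P, hP, h.symm, ?_⟩
  rw [hPdef, Unitary.conjStarAlgAut_apply, trace_mul_cycle, Unitary.coe_star_mul_self,
    Matrix.one_mul, trace_diagonal, traceNorm]
  push_cast
  rfl

theorem traceNorm_nonneg (X : Op ι) : 0 ≤ traceNorm X :=
  Finset.sum_nonneg fun _ _ => Real.sqrt_nonneg _

theorem norm_le_one_of_mem_unitaryGroup {U : Op ι} (hU : U ∈ unitaryGroup ι ℂ) : ‖U‖ ≤ 1 := by
  apply norm_le_one_of_posSemidef
  rw [show Uᴴ * U = 1 from mem_unitaryGroup_iff'.1 hU, sub_self]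
  exact PosSemidef.zero

theorem norm_trace_mul_le_traceNorm (Z X : Op ι) : ‖(Z * X).trace‖ ≤ ‖Z‖ * traceNorm X := by
  obtain ⟨U, hU, P, hP, hX, ht⟩ := exists_polar_traceNorm X
  rw [hX, ← Matrix.mul_assoc, ← hX]
  refine (norm_trace_mul_le _ hP).trans ?_
  rw [ht, Complex.ofReal_re]
  have := norm_mul_le Z U
  have h1 := norm_le_one_of_mem_unitaryGroup hU
  have h2 := traceNorm_nonneg X
  gcongr
  nlinarith [norm_nonneg Z]

/-- Conjugating a state by two contractions that are close in operator norm. -/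
theorem traceNorm_conj_sub_conj_le {A B ρ : Op ι} (hA : ‖A‖ ≤ 1) (hB : ‖B‖ ≤ 1)
    (hρ : IsDensity ρ) : traceNorm (conj A ρ - conj B ρ) ≤ 2 * ‖A - B‖ := by
  obtain ⟨U, hU, P, hP, hX, ht⟩ := exists_polar_traceNorm (conj A ρ - conj B ρ)
  have h1 : Uᴴ * U = 1 := mem_unitaryGroup_iff'.1 hU
  have hUn : ‖Uᴴ‖ ≤ 1 := by
    rw [l2_opNorm_conjTranspose]; exact norm_le_one_of_mem_unitaryGroup hU
  -- Telescoping: AρAᴴ − BρBᴴ = (A − B)ρAᴴ + Bρ(A − B)ᴴ, traced against Uᴴ.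
  have e : ((traceNorm (conj A ρ - conj B ρ) : ℝ) : ℂ) =
      ((Aᴴ * Uᴴ * (A - B)) * ρ).trace + (((A - B)ᴴ * Uᴴ * B) * ρ).trace := by
    rw [← ht]
    have : P = Uᴴ * (conj A ρ - conj B ρ) := by
      rw [hX, ← Matrix.mul_assoc, h1, Matrix.one_mul]
    have c1 : ((Aᴴ * Uᴴ * (A - B)) * ρ).trace = (Uᴴ * ((A - B) * ρ * Aᴴ)).trace := by
      rw [Matrix.mul_assoc, Matrix.mul_assoc, trace_mul_comm, Matrix.mul_assoc, Matrix.mul_assoc]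
    have c2 : (((A - B)ᴴ * Uᴴ * B) * ρ).trace = (Uᴴ * (B * ρ * (A - B)ᴴ)).trace := by
      rw [Matrix.mul_assoc, Matrix.mul_assoc, trace_mul_comm, Matrix.mul_assoc, Matrix.mul_assoc]
    rw [c1, c2, ← trace_add, ← Matrix.mul_add, this]
    congr 2
    simp only [conj, conjTranspose_sub, Matrix.sub_mul, Matrix.mul_sub]
    abel
  have hn : traceNorm (conj A ρ - conj B ρ) = ‖((traceNorm (conj A ρ - conj B ρ) : ℝ) : ℂ)‖ := by
    rw [Complex.norm_real, Real.norm_of_nonneg (traceNorm_nonneg _)]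
  have ht1 : ρ.trace.re = 1 := by rw [hρ.2]; rfl
  have b1 : ‖Aᴴ * Uᴴ * (A - B)‖ ≤ 1 * 1 * ‖A - B‖ := by
    refine (l2_opNorm_mul _ _).trans ?_
    gcongr
    refine (l2_opNorm_mul _ _).trans ?_
    rw [l2_opNorm_conjTranspose A]
    gcongr
  have b2 : ‖(A - B)ᴴ * Uᴴ * B‖ ≤ ‖A - B‖ * 1 * 1 := by
    refine (l2_opNorm_mul _ _).trans ?_
    gcongr
    refine (l2_opNorm_mul _ _).trans ?_
    rw [l2_opNorm_conjTranspose (A - B)]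
    gcongr
  rw [hn, e]
  refine (norm_add_le _ _).trans ?_
  have := norm_trace_mul_le (Aᴴ * Uᴴ * (A - B)) hρ.1
  have := norm_trace_mul_le ((A - B)ᴴ * Uᴴ * B) hρ.1
  rw [ht1] at *
  linarith

end QuantumCommitment

/-! ### Uhlmann's theorem, minimax, and continuity of the Stinespring dilation. -/

namespace QuantumCommitment

open Matrix

variable {ι : Type} [Fintype ι] [DecidableEq ι]

/-- Uhlmann's theorem: purifications with close marginals are close up to a contraction. -/
theorem exists_norm_le_one_le_trace {κ : Type} [Fintype κ] [DecidableEq κ] {A B : Matrix κ ι ℂ}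
    {η : ℝ} (hA : (Aᴴ * A).trace = 1) (hB : (Bᴴ * B).trace = 1)
    (h : ∀ E : Op ι, E.PosSemidef → (1 - E).PosSemidef →
      (E * (Aᴴ * A - Bᴴ * B)).trace.re ≤ η) :
    ∃ Y : Op κ, ‖Y‖ ≤ 1 ∧ 1 - η ≤ (Bᴴ * Y * A).trace.re := by
  obtain ⟨P, hP, hAP⟩ := (posSemidef_conjTranspose_mul_self A).exists_eq_conjTranspose_mul_self
  obtain ⟨Q, hQ, hBQ⟩ := (posSemidef_conjTranspose_mul_self B).exists_eq_conjTranspose_mul_self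
  obtain ⟨W, hW, -, hWA⟩ := exists_norm_le_one_mul_eq hAP
  obtain ⟨Z, hZ, -, hZB⟩ := exists_norm_le_one_mul_eq hBQ
  obtain ⟨E, hE, hE', hPS⟩ := hP.exists_trace_sq_sub_le hQ
  have hBZ : Bᴴ * Z = Q := by
    rw [← hQ.isHermitian.eq, ← hZB, conjTranspose_mul, conjTranspose_conjTranspose]
  rw [hP.isHermitian.eq] at hAP
  rw [hQ.isHermitian.eq] at hBQ
  -- With P = √(AᴴA) and Q = √(BᴴB), this choice makes the overlap equal to tr(QP). It need not be
  -- optimal, but Powers–Størmer bounds 2 − 2 tr(QP) by 2η.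
  refine ⟨Z * Wᴴ, ?_, ?_⟩
  · refine (l2_opNorm_mul _ _).trans ?_
    rw [l2_opNorm_conjTranspose]
    exact mul_le_one₀ hZ (norm_nonneg _) hW
  · rw [← Matrix.mul_assoc, hBZ, Matrix.mul_assoc, hWA]
    have hη := h E hE hE'
    rw [← hAP, ← hBQ] at hPS
    have c1 : ((P - Q) * (P - Q)).trace = 2 - 2 * (Q * P).trace := by
      simp only [Matrix.sub_mul, Matrix.mul_sub, trace_sub]
      rw [← hAP, ← hBQ, hA, hB, trace_mul_comm P Q]
      ring
    have c2 : (((2 : ℂ) • E - 1) * (Aᴴ * A - Bᴴ * B)).trace =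
        2 * (E * (Aᴴ * A - Bᴴ * B)).trace := by
      rw [Matrix.sub_mul, Matrix.one_mul, trace_sub, trace_sub, hA, hB, smul_mul, trace_smul]
      simp
    rw [c1, c2] at hPS
    simp at hPS
    linarith

theorem isCompact_setOf_isDensity : IsCompact {ρ : Op ι | IsDensity ρ} := by
  refine Metric.isCompact_of_isClosed_isBounded ?_ ?_
  · have h1 : IsClosed {ρ : Op ι | 0 ≤ ρ} := CStarAlgebra.isClosed_nonneg
    have h2 : IsClosed {ρ : Op ι | ρ.trace = 1} :=
      isClosed_eq (Continuous.matrix_trace continuous_id) continuous_const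
    have : {ρ : Op ι | IsDensity ρ} = {ρ | 0 ≤ ρ} ∩ {ρ | ρ.trace = 1} := Set.ext fun ρ => by
      change ρ.PosSemidef ∧ ρ.trace = 1 ↔ 0 ≤ ρ ∧ ρ.trace = 1
      rw [nonneg_iff_posSemidef]
    rw [this]
    exact h1.inter h2
  · refine isBounded_iff_forall_norm_le.2 ⟨1, fun ρ hρ => ?_⟩
    obtain ⟨hρ, ht⟩ := hρ
    rw [hρ.isHermitian.spectral_theorem, StarAlgEquiv.norm_map, l2_opNorm_diagonal,
      pi_norm_le_iff_of_nonneg zero_le_one]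
    intro i
    rw [hρ.isHermitian.trace_eq_sum_eigenvalues] at ht
    have ht' : ∑ i, hρ.isHermitian.eigenvalues i = 1 := by
      have := congrArg Complex.re ht
      simpa using this
    have := Finset.single_le_sum (f := hρ.isHermitian.eigenvalues)
      (fun i _ => hρ.eigenvalues_nonneg i) (Finset.mem_univ i)
    simp only [Function.comp_apply, RCLike.norm_ofReal]
    rw [abs_of_nonneg (hρ.eigenvalues_nonneg i)]
    linarith

theorem convex_setOf_isDensity : Convex ℝ {ρ : Op ι | IsDensity ρ} := by
  intro ρ hρ σ hσ a b ha hb hab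
  refine ⟨(hρ.1.smul ha).add (hσ.1.smul hb), ?_⟩
  rw [trace_add, trace_smul, trace_smul, hρ.2, hσ.2]
  simp only [Complex.real_smul, mul_one]
  exact_mod_cast hab

theorem exists_isDensity [Nonempty ι] : ∃ ρ : Op ι, IsDensity ρ := by
  obtain ⟨i⟩ := ‹Nonempty ι›
  refine ⟨diagonal (Pi.single i 1), PosSemidef.diagonal (Pi.single_nonneg.2 zero_le_one), ?_⟩
  simp [trace_diagonal]

variable {K D R : Type} [Fintype K] [DecidableEq K] [Fintype D] [DecidableEq D] [Fintype R]
  [DecidableEq R]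

/-- View an operator into `K × D` with domain `R` as an operator from `D × R` to `K`. -/
def reshape (X : Matrix (K × D) R ℂ) : Matrix K (D × R) ℂ :=
  Matrix.of fun k x => X (k, x.1) x.2

/-- Reshaping treats X as a purification whose discarded register is K: a contraction supplied by
Uhlmann's theorem acts on it as Y ⊗ 1. -/
theorem trace_reshape (X Z : Matrix (K × D) R ℂ) (Y : Op K) :
    ((reshape Z)ᴴ * Y * reshape X).trace = (Zᴴ * (Y ⊗ₖ (1 : Op D)) * X).trace := by
  simp only [trace, diag_apply, mul_apply, Fintype.sum_prod_type, conjTranspose_apply, reshape,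
    of_apply, kroneckerMap_apply, one_apply, mul_ite, mul_one, mul_zero, Finset.sum_ite_eq',
    Finset.mem_univ, if_true]
  rw [Finset.sum_comm]
  refine Finset.sum_congr rfl fun r _ => ?_
  rw [Finset.sum_comm]

theorem trace_reshape_self (X : Matrix (K × D) R ℂ) :
    ((reshape X)ᴴ * reshape X).trace = (Xᴴ * X).trace := by
  have := trace_reshape X X 1
  rwa [one_kronecker_one, Matrix.mul_one, Matrix.mul_one] at this

/-- Continuity of the Stinespring dilation: if the channels `Tr_K ∘ F` and `Tr_K ∘ G` are close in
diamond norm, then `F` and `G` are close up to a contraction on `K`. -/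
theorem exists_contraction_of_marginals_close [Nonempty ι] {F G : Matrix (K × D) ι ℂ} (e : ι ≃ R)
    (hF : Fᴴ * F = 1) (hG : Gᴴ * G = 1) {η : ℝ}
    (h : ∀ χ : Matrix ι R ℂ, (χᴴ * χ).trace = 1 → ∀ E : Op (D × R), E.PosSemidef →
      (1 - E).PosSemidef → (E * ((reshape (F * χ))ᴴ * reshape (F * χ) -
        (reshape (G * χ))ᴴ * reshape (G * χ))).trace.re ≤ η) :
    ∃ Y : Op K, ‖Y‖ ≤ 1 ∧ ∀ ρ : Op ι, IsDensity ρ →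
      1 - η ≤ (ρ * (Gᴴ * (Y ⊗ₖ (1 : Op D)) * F)).trace.re := by
  let f : Op ι → Op K → ℝ := fun ρ Y => (ρ * (Gᴴ * (Y ⊗ₖ (1 : Op D)) * F)).trace.re
  have hfl : ∀ ρ, ∀ Y Z : Op K, ∀ a b : ℝ, f ρ (a • Y + b • Z) = a * f ρ Y + b * f ρ Z := by
    intro ρ Y Z a b
    simp [f, add_kronecker, smul_kronecker, Matrix.mul_add, Matrix.add_mul]
  have hfl' : ∀ Y, ∀ ρ σ : Op ι, ∀ a b : ℝ, f (a • ρ + b • σ) Y = a * f ρ Y + b * f σ Y := by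
    intro ρ Y Z a b
    simp [f, Matrix.add_mul]
  have hball : Convex ℝ (Metric.closedBall (0 : Op K) 1) := convex_closedBall _ _
  have hc : ∀ ρ, Continuous (f ρ) := by
    intro ρ
    refine Complex.continuous_re.comp (Continuous.matrix_trace ?_)
    refine continuous_const.matrix_mul ((continuous_const.matrix_mul ?_).matrix_mul
      continuous_const)
    exact continuous_matrix fun i j => by
      simp only [kroneckerMap_apply]
      exact (continuous_id.matrix_elem _ _).mul continuous_const
  have hc' : ∀ Y, Continuous fun ρ => f ρ Y := by
    intro Y
    exact Complex.continuous_re.comp (Continuous.matrix_trace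
      (continuous_id.matrix_mul continuous_const))
  -- Uhlmann's Y depends on the state. The overlap is bilinear on two compact convex sets, so a
  -- saddle point exists and its Y₀ serves all states at once.
  obtain ⟨ρ₀, hρ₀, Y₀, hY₀, hs⟩ := Sion.exists_isSaddlePointOn (X := {ρ : Op ι | IsDensity ρ})
    (Y := Metric.closedBall (0 : Op K) 1) (f := f) exists_isDensity convex_setOf_isDensity
    isCompact_setOf_isDensity
    (fun Y _ => (hc' Y).lowerSemicontinuous.lowerSemicontinuousOn _)
    (fun Y _ => ConvexOn.quasiconvexOn
      ⟨convex_setOf_isDensity, fun ρ _ σ _ a b _ _ _ => (hfl' Y ρ σ a b).le⟩)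
    hball ⟨0, by simp⟩ (isCompact_closedBall _ _)
    (fun ρ _ => (hc ρ).upperSemicontinuous.upperSemicontinuousOn _)
    (fun ρ _ => ConcaveOn.quasiconcaveOn
      ⟨hball, fun Y _ Z _ a b _ _ _ => (hfl ρ Y Z a b).ge⟩)
  obtain ⟨X, hX, rfl⟩ := hρ₀.1.exists_eq_conjTranspose_mul_self
  -- It remains to find a good Y for the worst state ρ₀ alone; χ is a purification of ρ₀ with
  -- reference R ≃ ι.
  obtain ⟨χ, hχ⟩ : ∃ χ : Matrix ι R ℂ, χ * χᴴ = Xᴴ * X := by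
    refine ⟨Xᴴ.submatrix id e.symm, ?_⟩
    rw [conjTranspose_submatrix, submatrix_mul_equiv, conjTranspose_conjTranspose, submatrix_id_id]
  have hiso : ∀ H : Matrix (K × D) ι ℂ, Hᴴ * H = 1 →
      ((reshape (H * χ))ᴴ * reshape (H * χ)).trace = 1 := by
    intro H hH
    rw [trace_reshape_self, conjTranspose_mul, Matrix.mul_assoc, ← Matrix.mul_assoc Hᴴ, hH,
      Matrix.one_mul, trace_mul_comm, hχ, hρ₀.2]
  have ht : (χᴴ * χ).trace = 1 := by rw [trace_mul_comm, hχ, hρ₀.2]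
  obtain ⟨Y, hY, hle⟩ := exists_norm_le_one_le_trace (hiso F hF) (hiso G hG) (h χ ht)
  refine ⟨Y₀, by simpa using hY₀, fun ρ hρ => hle.trans ((le_of_eq ?_).trans
    (hs ρ hρ Y (by simpa using hY)))⟩
  rw [trace_reshape]
  simp only [f]
  rw [← hχ, conjTranspose_mul, Matrix.mul_assoc χ, trace_mul_comm χ]
  simp only [Matrix.mul_assoc]

theorem conjTranspose_sub_mul_sub_trace {L : Type} [Fintype L] [DecidableEq L]
    {F G : Matrix L ι ℂ} (hF : Fᴴ * F = 1) (hG : Gᴴ * G = 1) {ρ : Op ι} (hρ : IsDensity ρ) :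
    (ρ * ((F - G)ᴴ * (F - G))).trace.re = 2 - 2 * (ρ * (Gᴴ * F)).trace.re := by
  have : (ρ * (Fᴴ * G)).trace = star (ρ * (Gᴴ * F)).trace := by
    rw [← trace_conjTranspose, conjTranspose_mul, conjTranspose_mul, conjTranspose_conjTranspose,
      hρ.1.isHermitian.eq, trace_mul_comm]
  simp only [conjTranspose_sub, Matrix.sub_mul, Matrix.mul_sub, hF, hG, trace_sub,
    Matrix.mul_one, hρ.2, this]
  simp
  ring

/-- Testing on normalized rank-one states recovers ‖T x‖² / ‖x‖². -/
theorem norm_le_of_trace_conjTranspose_mul_self_le {L : Type} [Fintype L] [DecidableEq L]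
    (T : Matrix L ι ℂ) {c : ℝ} (hc : 0 ≤ c)
    (h : ∀ ρ : Op ι, IsDensity ρ → (ρ * (Tᴴ * T)).trace.re ≤ c ^ 2) : ‖T‖ ≤ c := by
  refine norm_le_of_norm_toLp_mulVec_le T hc fun x => ?_
  rcases eq_or_ne x 0 with rfl | hx
  · simp
  have hN : 0 < ‖WithLp.toLp 2 x‖ := by simpa using hx
  have hxx : star x ⬝ᵥ x = ((‖WithLp.toLp 2 x‖ ^ 2 : ℝ) : ℂ) := by
    rw [← inner_self_eq_norm_sq (𝕜 := ℂ), EuclideanSpace.inner_eq_star_dotProduct, dotProduct_comm]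
    exact (Complex.conj_eq_iff_re.1 (by simp [dotProduct, mul_comm])).symm
  have key : (vecMulVec x (star x) * (Tᴴ * T)).trace.re = ‖WithLp.toLp 2 (T *ᵥ x)‖ ^ 2 := by
    rw [norm_toLp_sq_eq_re, trace_mul_comm, mul_vecMulVec, trace_vecMulVec, star_mulVec,
      dotProduct_comm, ← dotProduct_mulVec, mulVec_mulVec]
  have hd : IsDensity ((‖WithLp.toLp 2 x‖ ^ 2)⁻¹ • vecMulVec x (star x)) := by
    refine ⟨(posSemidef_vecMulVec_self_star x).smul (by positivity), ?_⟩
    rw [trace_smul, trace_vecMulVec, dotProduct_comm, hxx, Complex.real_smul, ← Complex.ofReal_mul,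
      inv_mul_cancel₀ (by positivity), Complex.ofReal_one]
  have := h _ hd
  rw [smul_mul, trace_smul, Complex.smul_re, key, smul_eq_mul, inv_mul_le_iff₀ (by positivity),
    mul_comm, ← mul_pow] at this
  exact le_of_sq_le_sq this (by positivity)

/-- The contraction is the mean of unitaries U and V. In every state the squared errors of U and V
are nonnegative and sum to at most 4η, so U alone has squared error at most 4η = (2√η)². -/
theorem exists_unitary_of_marginals_close [Nonempty ι] {F G : Matrix (K × D) ι ℂ} (e : ι ≃ R)
    (hF : Fᴴ * F = 1) (hG : Gᴴ * G = 1) {η : ℝ} (hη : 0 ≤ η)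
    (h : ∀ χ : Matrix ι R ℂ, (χᴴ * χ).trace = 1 → ∀ E : Op (D × R), E.PosSemidef →
      (1 - E).PosSemidef → (E * ((reshape (F * χ))ᴴ * reshape (F * χ) -
        (reshape (G * χ))ᴴ * reshape (G * χ))).trace.re ≤ η) :
    ∃ U ∈ unitaryGroup K ℂ, ‖(U ⊗ₖ (1 : Op D)) * F - G‖ ≤ 2 * √η := by
  obtain ⟨Y, hY, hρ⟩ := exists_contraction_of_marginals_close e hF hG h
  obtain ⟨U, hU, V, hV, hUV⟩ := exists_mem_unitaryGroup_add_eq hY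
  have hiso : ∀ W ∈ unitaryGroup K ℂ, ((W ⊗ₖ (1 : Op D)) * F)ᴴ * ((W ⊗ₖ (1 : Op D)) * F) = 1 := by
    intro W hW
    rw [conjTranspose_mul, Matrix.mul_assoc, ← Matrix.mul_assoc _ _ F, conjTranspose_kronecker,
      ← mul_kronecker_mul, show Wᴴ * W = 1 from mem_unitaryGroup_iff'.1 hW, conjTranspose_one,
      Matrix.one_mul, one_kronecker_one, Matrix.one_mul, hF]
  refine ⟨U, hU, norm_le_of_trace_conjTranspose_mul_self_le _ (by positivity) fun ρ hd => ?_⟩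
  have h1 := conjTranspose_sub_mul_sub_trace (hiso U hU) hG hd
  have h2 := conjTranspose_sub_mul_sub_trace (hiso V hV) hG hd
  have h3 := (Complex.le_def.1 (hd.1.trace_mul_nonneg
    (posSemidef_conjTranspose_mul_self ((V ⊗ₖ (1 : Op D)) * F - G)))).1
  have h4 := hρ ρ hd
  have h5 : (ρ * (Gᴴ * ((U ⊗ₖ (1 : Op D)) * F))).trace + (ρ * (Gᴴ * ((V ⊗ₖ (1 : Op D)) * F))).trace
      = 2 * (ρ * (Gᴴ * (Y ⊗ₖ (1 : Op D)) * F)).trace := by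
    rw [← trace_add, ← Matrix.mul_add, ← Matrix.mul_add, ← Matrix.add_mul, ← add_kronecker, hUV,
      smul_kronecker, smul_mul, Matrix.mul_smul, Matrix.mul_smul, trace_smul, smul_eq_mul,
      Matrix.mul_assoc Gᴴ]
  have h6 := congrArg Complex.re h5
  simp only [Complex.add_re, Complex.mul_re, Complex.re_ofNat, Complex.im_ofNat,
    Complex.zero_re] at h6 h3
  rw [h1, mul_pow, Real.sq_sqrt hη]
  linarith

end QuantumCommitment

/-! ### Register calculus, the encoding isometry and the encoded swap. -/

namespace QuantumCommitment

open Matrix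

section

variable {α β γ : Type} [Fintype α] [DecidableEq α] [Fintype β] [DecidableEq β] [Fintype γ]
  [DecidableEq γ]

theorem conj_conj (A : Matrix γ β ℂ) (B : Matrix β α ℂ) (ρ : Op α) :
    conj A (conj B ρ) = conj (A * B) ρ := by
  simp only [conj, conjTranspose_mul, Matrix.mul_assoc]

theorem conj_kronecker (A : Matrix β α ℂ) (ρ : Op α) (σ : Op γ) :
    conj A ρ ⊗ₖ σ = conj (A ⊗ₖ (1 : Op γ)) (ρ ⊗ₖ σ) := by
  simp only [conj, conjTranspose_kronecker, conjTranspose_one, ← mul_kronecker_mul, Matrix.one_mul,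
    Matrix.mul_one]

theorem trace_conj (A : Matrix β α ℂ) (ρ : Op α) : (conj A ρ).trace = (Aᴴ * A * ρ).trace := by
  rw [conj, trace_mul_comm, Matrix.mul_assoc]

theorem posSemidef_conj (A : Matrix β α ℂ) {ρ : Op α} (hρ : ρ.PosSemidef) :
    (conj A ρ).PosSemidef :=
  hρ.mul_mul_conjTranspose_same A

/-- The operator that maps the basis vector `|a⟩` to `|f a⟩`. -/
def basisMap (f : α → β) : Matrix β α ℂ := (1 : Op β).submatrix id f

theorem mul_basisMap (A : Matrix γ β ℂ) (f : α → β) : A * basisMap f = A.submatrix id f := by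
  ext i j
  simp [basisMap, mul_apply, one_apply]

theorem conjTranspose_basisMap_mul_self {f : α → β} (hf : Function.Injective f) :
    (basisMap f)ᴴ * basisMap f = 1 := by
  ext i j
  rw [mul_basisMap]
  simp [basisMap, one_apply, hf.eq_iff]

theorem basisMap_mul (f : β → γ) (g : α → β) : basisMap f * basisMap g = basisMap (f ∘ g) := by
  rw [mul_basisMap]
  rfl

theorem one_kronecker_ketbraZero (k : ℕ) :
    (1 : Op α) ⊗ₖ ketbraZero k =
      basisMap (fun a : α => (a, fun _ : Fin k => false)) *
        (basisMap fun a : α => (a, fun _ => false))ᴴ := by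
  ext ⟨a, x⟩ ⟨b, y⟩
  simp only [kroneckerMap_apply, ketbraZero, single_apply, one_apply, mul_apply, basisMap,
    submatrix_apply, conjTranspose_apply, Prod.mk.injEq, id]
  by_cases hx : x = fun _ => false <;> by_cases hy : y = fun _ => false <;>
    simp [hx, hy, eq_comm]

theorem basisMap_kronecker_one (f : α → β) :
    basisMap f ⊗ₖ (1 : Op γ) = basisMap (Prod.map f id) := by
  ext ⟨a, x⟩ ⟨b, y⟩
  simp only [basisMap, kroneckerMap_apply, submatrix_apply, one_apply, Prod.map_apply, Prod.ext_iff,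
    id, mul_ite, mul_one, mul_zero]
  split_ifs <;> simp_all

theorem posSemidef_ketbraZero (k : ℕ) : (ketbraZero k).PosSemidef := by
  have : ketbraZero k = vecMulVec (Pi.single (fun _ => false) 1)
      (star (Pi.single (fun _ => false) 1)) := by
    ext x y
    simp only [ketbraZero, single_apply, vecMulVec_apply, Pi.star_apply, Pi.single_apply]
    split_ifs <;> simp_all
  rw [this]
  exact posSemidef_vecMulVec_self_star _

theorem trace_ketbraZero (k : ℕ) : (ketbraZero k).trace = 1 := by
  simp [ketbraZero]

/-- Operators on the first factor of `β × γ ≃ α`, as operators on `α`. -/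
def place (e : α ≃ β × γ) (X : Op β) : Op α := (X ⊗ₖ (1 : Op γ)).submatrix e e

theorem place_mul (e : α ≃ β × γ) (X Y : Op β) : place e X * place e Y = place e (X * Y) := by
  rw [place, place, submatrix_mul_equiv, ← mul_kronecker_mul, Matrix.one_mul, place]

theorem place_sub (e : α ≃ β × γ) (X Y : Op β) : place e X - place e Y = place e (X - Y) := by
  ext i j
  simp [place, sub_mul]

theorem place_one (e : α ≃ β × γ) : place e (1 : Op β) = 1 := by
  rw [place, one_kronecker_one, submatrix_one_equiv]

theorem conjTranspose_place (e : α ≃ β × γ) (X : Op β) : (place e X)ᴴ = place e Xᴴ := by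
  rw [place, conjTranspose_submatrix, conjTranspose_kronecker, conjTranspose_one, place]

/-- `place e` is a star homomorphism of C*-algebras, hence contractive. -/
theorem norm_place_le (e : α ≃ β × γ) (X : Op β) : ‖place e X‖ ≤ ‖X‖ := by
  let φ : Op β →⋆ₙₐ[ℂ] Op α :=
    { toFun := place e
      map_smul' := fun c X => by ext i j; simp [place, mul_assoc]
      map_zero' := by ext i j; simp [place]
      map_add' := fun X Y => by ext i j; simp [place, add_mul]
      map_mul' := fun X Y => (place_mul e X Y).symm
      map_star' := fun X => (conjTranspose_place e X).symm }
  exact NonUnitalStarAlgHom.norm_apply_le φ X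

theorem place_mem_unitaryGroup (e : α ≃ β × γ) {U : Op β} (hU : U ∈ unitaryGroup β ℂ) :
    place e U ∈ unitaryGroup α ℂ := by
  rw [mem_unitaryGroup_iff', star_eq_conjTranspose, conjTranspose_place, place_mul,
    show Uᴴ * U = 1 from mem_unitaryGroup_iff'.1 hU, place_one]

/-- Conjugation by an operator, as a linear map. -/
def conjLinear (U : Op β) : Op β →ₗ[ℂ] Op β where
  toFun := conj U
  map_add' X Y := by simp only [conj, Matrix.mul_add, Matrix.add_mul]
  map_smul' c X := by simp only [conj, Matrix.mul_smul, smul_mul, RingHom.id_apply]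

theorem ampliate_conjLinear (U : Op β) (ρ : Op (β × γ)) :
    ampliate (conjLinear U) γ ρ = conj (U ⊗ₖ (1 : Op γ)) ρ := by
  ext ⟨i, x⟩ ⟨j, y⟩
  change (U * (of fun i j => ρ (i, x) (j, y)) * Uᴴ) i j = _
  simp [conj, mul_apply, Fintype.sum_prod_type, one_apply, apply_ite]

theorem isCPTP_conjLinear {U : Op β} (hU : U ∈ unitaryGroup β ℂ) : IsCPTP (conjLinear U) where
  completelyPositive k ρ hρ := by
    rw [ampliate_conjLinear]
    exact posSemidef_conj _ hρ
  tracePreserving ρ := by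
    change (conj U ρ).trace = _
    rw [trace_conj, show Uᴴ * U = 1 from mem_unitaryGroup_iff'.1 hU, Matrix.one_mul]

end

theorem trace_submatrix_equiv {α β : Type} [Fintype α] [Fintype β] (e : α ≃ β) (X : Op β) :
    (X.submatrix e e).trace = X.trace := by
  simp only [trace, diag_apply, submatrix_apply]
  exact e.sum_comp fun i => X i i

theorem trace_one_kronecker_mul {α β : Type} [Fintype α] [DecidableEq α] [Fintype β] (E : Op β)
    (X : Op (α × β)) : (((1 : Op α) ⊗ₖ E) * X).trace = (E * traceFst X).trace := by
  simp only [trace, diag_apply, mul_apply, Fintype.sum_prod_type, kroneckerMap_apply, one_apply,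
    ite_mul, one_mul, zero_mul, traceFst, of_apply, Finset.mul_sum]
  rw [Finset.sum_comm]
  refine Finset.sum_congr rfl fun y _ => ?_
  simp only [Finset.sum_comm (s := (Finset.univ : Finset α)), Finset.sum_ite_eq, Finset.mem_univ,
    if_true]

namespace QSC

variable (S : QSC) (s : ℕ)

/-- The encoding isometry `|m⟩ ↦ Com |m⟩ |0⟩`. -/
def encode : Matrix (S.C s × S.D s) (S.M s) ℂ :=
  (S.com s).submatrix id fun m => (m, fun _ => false)

theorem encode_isometry : (S.encode s)ᴴ * S.encode s = 1 := by
  rw [encode, ← mul_basisMap, conjTranspose_mul, Matrix.mul_assoc, ← Matrix.mul_assoc _ (S.com s),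
    S.com_isometry, Matrix.one_mul, conjTranspose_basisMap_mul_self]
  intro a b h
  exact (Prod.mk.inj h).1

/-- The encoding isometry tensored with the identity on `M'`, as a map into `((C, M'), D)`. -/
def encodeCM : Matrix ((S.C s × S.M s) × S.D s) (S.M s × S.M s) ℂ :=
  (S.encode s ⊗ₖ (1 : Op (S.M s))).submatrix (fun x => ((x.1.1, x.2), x.1.2)) id

theorem encodeCM_isometry : (S.encodeCM s)ᴴ * S.encodeCM s = 1 := by
  let e : (S.C s × S.M s) × S.D s ≃ (S.C s × S.D s) × S.M s :=
    ⟨fun x => ((x.1.1, x.2), x.1.2), fun x => ((x.1.1, x.2), x.1.2), fun _ => rfl, fun _ => rfl⟩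
  have : S.encodeCM s = (S.encode s ⊗ₖ (1 : Op (S.M s))).submatrix e id := rfl
  rw [this, conjTranspose_submatrix, submatrix_mul_equiv, conjTranspose_kronecker,
    ← mul_kronecker_mul, encode_isometry, conjTranspose_one, Matrix.one_mul, one_kronecker_one,
    submatrix_id_id]

/-- The swap of `M` and `M'`. -/
def swapMM : Op (S.M s × S.M s) := basisMap Prod.swap

theorem swapMM_isometry : (S.swapMM s)ᴴ * S.swapMM s = 1 :=
  conjTranspose_basisMap_mul_self Prod.swap_injective

theorem swapMM_isHermitian : (S.swapMM s)ᴴ = S.swapMM s := by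
  ext ⟨a, b⟩ ⟨c, d⟩
  simp [swapMM, basisMap, one_apply, and_comm, eq_comm]

/-- The reordering of `(C, D, H, M')` as `(((C, M'), D), H)`. -/
def regroupH (h : ℕ) :
    (((S.C s × S.D s) × Qubits h) × S.M s) ≃ (((S.C s × S.M s) × S.D s) × Qubits h) where
  toFun x := (((x.1.1.1, x.2), x.1.1.2), x.1.2)
  invFun y := (((y.1.1.1, y.1.2), y.2), y.1.1.2)
  left_inv _ := rfl
  right_inv _ := rfl

/-- The encoding isometry tensored with the identity on `(H, M')`. -/
def encodeFull (h : ℕ) :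
    Matrix (((S.C s × S.D s) × Qubits h) × S.M s) ((S.M s × Qubits h) × S.M s) ℂ :=
  (S.encode s ⊗ₖ (1 : Op (Qubits h))) ⊗ₖ (1 : Op (S.M s))

/-- The reordering of `(M, H, M')` as `((M, M'), H)`. -/
def regroupM (h : ℕ) : ((S.M s × Qubits h) × S.M s) ≃ ((S.M s × S.M s) × Qubits h) where
  toFun x := ((x.1.1, x.2), x.1.2)
  invFun y := ((y.1.1, y.2), y.1.2)
  left_inv _ := rfl
  right_inv _ := rfl

theorem encodeFull_eq (h : ℕ) : S.encodeFull s h =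
    (S.encodeCM s ⊗ₖ (1 : Op (Qubits h))).submatrix (S.regroupH s h) (S.regroupM s h) := by
  ext ⟨⟨⟨c, d⟩, x⟩, m⟩ ⟨⟨m1, y⟩, m2⟩
  simp only [encodeFull, encodeCM, regroupH, regroupM, kroneckerMap_apply, submatrix_apply,
    Equiv.coe_fn_mk, id]
  ring

/-- The swap of `M` and `M'` on `(M, H, M')`. -/
def swapFull (h : ℕ) : Op ((S.M s × Qubits h) × S.M s) :=
  basisMap fun x => ((x.2, x.1.2), x.1.1)

theorem swapFull_eq_place (h : ℕ) : S.swapFull s h = place (S.regroupM s h) (S.swapMM s) := by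
  rw [place, swapMM, basisMap_kronecker_one]
  ext i j
  simp [swapFull, basisMap, one_apply, regroupM, Prod.ext_iff, and_comm, and_assoc]

/-- The inclusion of `(M, H, M')` into `(M, W, H, M')` with `W` in state `|0⟩`. -/
def zeroW (h : ℕ) : Matrix (((S.M s × S.W s) × Qubits h) × S.M s) ((S.M s × Qubits h) × S.M s) ℂ :=
  basisMap fun x => (((x.1.1, fun _ => false), x.1.2), x.2)

theorem zeroW_mul_conjTranspose (h : ℕ) : S.zeroW s h * (S.zeroW s h)ᴴ =
    ((((1 : Op (S.M s)) ⊗ₖ ketbraZero s) ⊗ₖ (1 : Op (Qubits h))) ⊗ₖ (1 : Op (S.M s))) := by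
  have : S.zeroW s h = (basisMap (fun a : S.M s => (a, fun _ : Fin s => false)) ⊗ₖ
      (1 : Op (Qubits h))) ⊗ₖ (1 : Op (S.M s)) := by
    rw [basisMap_kronecker_one, basisMap_kronecker_one]
    rfl
  rw [this, one_kronecker_ketbraZero]
  simp only [conjTranspose_kronecker, conjTranspose_one, ← mul_kronecker_mul, Matrix.one_mul]

theorem comFull_mul_zeroW (h : ℕ) : S.comFull s h * S.zeroW s h = S.encodeFull s h := by
  rw [zeroW, mul_basisMap]
  rfl

theorem comFull_isometry (h : ℕ) : (S.comFull s h)ᴴ * S.comFull s h = 1 := by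
  simp only [comFull, conjTranspose_kronecker, conjTranspose_one, ← mul_kronecker_mul,
    Matrix.one_mul, S.com_isometry, one_kronecker_one]

theorem comFull_coisometry (h : ℕ) : S.comFull s h * (S.comFull s h)ᴴ = 1 := by
  simp only [comFull, conjTranspose_kronecker, conjTranspose_one, ← mul_kronecker_mul,
    Matrix.one_mul, S.com_coisometry, one_kronecker_one]

theorem validProj_eq_conj_zeroW (h : ℕ) : S.validProj s h =
    S.comFull s h * (S.zeroW s h * (S.zeroW s h)ᴴ) * (S.comFull s h)ᴴ := by
  rw [zeroW_mul_conjTranspose]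
  simp only [validProj, conj, comFull, conjTranspose_kronecker, conjTranspose_one,
    ← mul_kronecker_mul, Matrix.one_mul]

theorem validProj_eq_encodeFull (h : ℕ) :
    S.validProj s h = S.encodeFull s h * (S.encodeFull s h)ᴴ := by
  rw [validProj_eq_conj_zeroW, ← comFull_mul_zeroW, conjTranspose_mul]
  simp only [Matrix.mul_assoc]

theorem validProj_eq_place (h : ℕ) :
    S.validProj s h = place (S.regroupH s h) (S.encodeCM s * (S.encodeCM s)ᴴ) := by
  rw [validProj_eq_encodeFull, encodeFull_eq, conjTranspose_submatrix, submatrix_mul_equiv,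
    conjTranspose_kronecker, conjTranspose_one, ← mul_kronecker_mul, Matrix.one_mul, place]

theorem swap_eq_basisMap (h : ℕ) :
    S.swap s h = basisMap fun x => (((x.2, x.1.1.2), x.1.2), x.1.1.1) := by
  ext i j
  simp only [swap, basisMap, of_apply, submatrix_apply, one_apply, id]

theorem swap_mul_zeroW (h : ℕ) :
    S.swap s h * S.zeroW s h = S.zeroW s h * S.swapFull s h := by
  rw [swap_eq_basisMap, zeroW, swapFull, basisMap_mul, basisMap_mul]
  rfl

theorem swap_conjTranspose (h : ℕ) : (S.swap s h)ᴴ = S.swap s h := by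
  ext ⟨⟨⟨m, w⟩, x⟩, m'⟩ ⟨⟨⟨m1, w1⟩, y⟩, m2⟩
  simp only [swap, conjTranspose_apply, of_apply, Prod.mk.injEq]
  split_ifs <;> simp_all

theorem swap_mul_self (h : ℕ) : S.swap s h * S.swap s h = 1 := by
  rw [swap_eq_basisMap, basisMap_mul]
  exact submatrix_id_id 1

theorem swapHat_conjTranspose (h : ℕ) : (S.swapHat s h)ᴴ = S.swapHat s h := by
  rw [swapHat, conj, conjTranspose_mul, conjTranspose_mul, conjTranspose_conjTranspose,
    swap_conjTranspose, Matrix.mul_assoc]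

theorem swapHat_mul_comFull (h : ℕ) :
    S.swapHat s h * S.comFull s h = S.comFull s h * S.swap s h := by
  rw [swapHat, conj, Matrix.mul_assoc, comFull_isometry, Matrix.mul_one]

theorem swapHat_mul_self (h : ℕ) : S.swapHat s h * S.swapHat s h = 1 := by
  nth_rw 2 [swapHat]
  rw [conj, ← Matrix.mul_assoc, ← Matrix.mul_assoc, swapHat_mul_comFull,
    Matrix.mul_assoc (S.comFull s h), swap_mul_self, Matrix.mul_one, comFull_coisometry]

theorem swapHat_mem_unitaryGroup (h : ℕ) : S.swapHat s h ∈ unitaryGroup _ ℂ := by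
  rw [mem_unitaryGroup_iff', star_eq_conjTranspose, swapHat_conjTranspose, swapHat_mul_self]

theorem swapHat_mul_encodeFull (h : ℕ) :
    S.swapHat s h * S.encodeFull s h = S.encodeFull s h * S.swapFull s h := by
  rw [← comFull_mul_zeroW, ← Matrix.mul_assoc, swapHat_mul_comFull, Matrix.mul_assoc,
    swap_mul_zeroW, Matrix.mul_assoc]

/-- On the code space W is |0⟩ and H is a spectator, so the encoded swap becomes an operator built
from `encodeCM` alone. This reduces extraction to comparing two isometries. -/
theorem swapHat_mul_validProj (h : ℕ) : S.swapHat s h * S.validProj s h =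
    place (S.regroupH s h) (S.encodeCM s * S.swapMM s * (S.encodeCM s)ᴴ) := by
  rw [validProj_eq_encodeFull, ← Matrix.mul_assoc, swapHat_mul_encodeFull, encodeFull_eq,
    swapFull_eq_place, place, submatrix_mul_equiv, conjTranspose_submatrix, submatrix_mul_equiv,
    conjTranspose_kronecker, conjTranspose_one, ← mul_kronecker_mul, ← mul_kronecker_mul,
    Matrix.one_mul, Matrix.one_mul, place]

theorem validProj_conjTranspose (h : ℕ) : (S.validProj s h)ᴴ = S.validProj s h := by
  rw [validProj_eq_encodeFull, conjTranspose_mul, conjTranspose_conjTranspose]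

theorem encodeFull_isometry (h : ℕ) : (S.encodeFull s h)ᴴ * S.encodeFull s h = 1 := by
  simp only [encodeFull, conjTranspose_kronecker, conjTranspose_one, ← mul_kronecker_mul,
    Matrix.one_mul, S.encode_isometry, one_kronecker_one]

theorem validProj_mul_self (h : ℕ) : S.validProj s h * S.validProj s h = S.validProj s h := by
  rw [validProj_eq_encodeFull, Matrix.mul_assoc, ← Matrix.mul_assoc _ (S.encodeFull s h),
    encodeFull_isometry, Matrix.one_mul]

/-- Two Hermitian operators commute when their product is Hermitian, and the product found in
`swapHat_mul_validProj` is. -/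
theorem validProj_mul_swapHat (h : ℕ) :
    S.validProj s h * S.swapHat s h = S.swapHat s h * S.validProj s h := by
  rw [← validProj_conjTranspose, ← swapHat_conjTranspose, ← conjTranspose_mul,
    swapHat_mul_validProj, conjTranspose_place, conjTranspose_mul, conjTranspose_mul,
    conjTranspose_conjTranspose, swapMM_isHermitian, swapHat_conjTranspose,
    validProj_conjTranspose, swapHat_mul_validProj, Matrix.mul_assoc]

theorem norm_validProj_le (h : ℕ) : ‖S.validProj s h‖ ≤ 1 := by
  have := l2_opNorm_conjTranspose_mul_self (S.validProj s h)
  rw [validProj_conjTranspose, validProj_mul_self] at this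
  nlinarith [norm_nonneg (S.validProj s h)]

variable {S s}

theorem onCM_conjLinear (U : Op (S.C s × S.M s)) {h : ℕ}
    (ρ : Op (((S.C s × S.D s) × Qubits h) × S.M s)) :
    onCM (conjLinear U) ρ = conj (place (S.regroup s h) U) ρ := by
  rw [onCM, ampliate_conjLinear, conj, conj, place, conjTranspose_submatrix]
  simp only [reindex_apply, Equiv.symm_symm]
  rw [← submatrix_mul_equiv _ _ _ (S.regroup s h) _, ← submatrix_mul_equiv _ _ _ (S.regroup s h) _]
  congr 2

theorem place_regroup (U : Op (S.C s × S.M s)) (h : ℕ) :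
    place (S.regroup s h) U = place (S.regroupH s h) (U ⊗ₖ (1 : Op (S.D s))) := by
  rw [place, place, ← one_kronecker_one]
  ext ⟨⟨⟨c, d⟩, x⟩, m⟩ ⟨⟨⟨c', d'⟩, x'⟩, m'⟩
  simp only [regroup, regroupH, kroneckerMap_apply, submatrix_apply, Equiv.coe_fn_mk]
  ring

theorem onDH_eq {h : ℕ} (U : Op (S.D s × Qubits h)) :
    S.onDH s U = ((1 : Op (S.C s × S.M s)) ⊗ₖ U).submatrix (S.regroup s h) (S.regroup s h) := by
  ext ⟨⟨⟨c, d⟩, x⟩, m⟩ ⟨⟨⟨c', d'⟩, x'⟩, m'⟩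
  simp only [onDH, regroup, kroneckerMap_apply, submatrix_apply, Equiv.coe_fn_mk, reindex_apply,
    Equiv.symm_symm, Equiv.prodAssoc_apply, one_apply, Prod.mk.injEq]
  by_cases h1 : c = c' <;> by_cases h2 : m = m' <;> simp [h1, h2]

/-- The registers are disjoint. This allows a unitary on (D,H) to be absorbed into the input state.
-/
theorem place_mul_onDH {h : ℕ} (Y : Op (S.C s × S.M s)) (U : Op (S.D s × Qubits h)) :
    place (S.regroup s h) Y * S.onDH s U = S.onDH s U * place (S.regroup s h) Y := by
  rw [onDH_eq, place, submatrix_mul_equiv, submatrix_mul_equiv, ← mul_kronecker_mul,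
    ← mul_kronecker_mul, Matrix.one_mul, Matrix.mul_one, Matrix.one_mul, Matrix.mul_one]

theorem onDH_mul {h : ℕ} (U V : Op (S.D s × Qubits h)) :
    S.onDH s U * S.onDH s V = S.onDH s (U * V) := by
  rw [onDH_eq, onDH_eq, onDH_eq, submatrix_mul_equiv, ← mul_kronecker_mul, Matrix.one_mul]

theorem onDH_one {h : ℕ} : S.onDH s (1 : Op (S.D s × Qubits h)) = 1 := by
  rw [onDH_eq, one_kronecker_one, submatrix_one_equiv]

theorem onDH_conjTranspose {h : ℕ} (U : Op (S.D s × Qubits h)) :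
    (S.onDH s U)ᴴ = S.onDH s Uᴴ := by
  rw [onDH_eq, onDH_eq, conjTranspose_submatrix, conjTranspose_kronecker, conjTranspose_one]

theorem onDH_sub {h : ℕ} (U V : Op (S.D s × Qubits h)) :
    S.onDH s (U - V) = S.onDH s U - S.onDH s V := by
  rw [onDH_eq, onDH_eq, onDH_eq]
  ext i j
  simp [mul_sub]

theorem posSemidef_onDH {h : ℕ} {U : Op (S.D s × Qubits h)} (hU : U.PosSemidef) :
    (S.onDH s U).PosSemidef := by
  rw [onDH_eq]
  exact (PosSemidef.one.kronecker hU).submatrix _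

theorem traceFst_traceSnd {h : ℕ} (X : Op (((S.C s × S.D s) × Qubits h) × S.M s)) :
    traceFst (reindex (Equiv.prodAssoc _ _ _) (Equiv.prodAssoc _ _ _) (traceSnd X)) =
      traceFst (X.submatrix (S.regroup s h).symm (S.regroup s h).symm) := by
  ext ⟨d, x⟩ ⟨d', x'⟩
  simp [traceFst, traceSnd, regroup, Fintype.sum_prod_type]

theorem trace_onDH_mul {h : ℕ} (E : Op (S.D s × Qubits h))
    (X : Op (((S.C s × S.D s) × Qubits h) × S.M s)) : (S.onDH s E * X).trace =
      (E * traceFst (X.submatrix (S.regroup s h).symm (S.regroup s h).symm)).trace := by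
  rw [← trace_one_kronecker_mul, onDH_eq]
  set Y := X.submatrix (S.regroup s h).symm (S.regroup s h).symm with hY
  have : X = Y.submatrix (S.regroup s h) (S.regroup s h) := by simp [hY]
  rw [this, submatrix_mul_equiv, trace_submatrix_equiv]

end QSC

end QuantumCommitment

/-! ### Swap binding implies extractability. -/

namespace QuantumCommitment

open Matrix

section

variable {α β γ : Type} [Fintype α] [DecidableEq α] [Fintype β] [DecidableEq β] [Fintype γ]
  [DecidableEq γ]

theorem trace_traceFst (X : Op (α × β)) : (traceFst X).trace = X.trace := by
  simp only [trace, diag_apply, traceFst, of_apply, Fintype.sum_prod_type]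
  exact Finset.sum_comm

theorem traceSnd_conj_kronecker_one (A : Matrix γ α ℂ) (X : Op (α × β)) :
    traceSnd (conj (A ⊗ₖ (1 : Op β)) X) = conj A (traceSnd X) := by
  ext i j
  simp only [traceSnd, conj, of_apply, mul_apply, Fintype.sum_prod_type, kroneckerMap_apply,
    one_apply, conjTranspose_apply, mul_ite, ite_mul, mul_one, mul_zero, zero_mul,
    Finset.sum_ite_eq, Finset.mem_univ, if_true, apply_ite star, star_zero]
  simp only [Finset.mul_sum, Finset.sum_mul]
  rw [Finset.sum_comm]
  refine Finset.sum_congr rfl fun a _ => ?_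
  rw [Finset.sum_comm]

theorem traceSnd_kronecker (X : Op α) (Y : Op β) : traceSnd (X ⊗ₖ Y) = Y.trace • X := by
  ext i j
  simp [traceSnd, trace, Finset.mul_sum, mul_comm]

end

namespace QSC

variable {S : QSC} {s : ℕ}

/-- The joint state of `(C, D, H, E)` after the challenger with bit `b` has applied `Com`. -/
def challengeState (A : S.Adversary s) (b : Bool) : Op (((S.C s × S.D s) × Qubits A.h) × S.M s) :=
  conj (if b then S.swapHat s A.h * S.validProj s A.h else S.validProj s A.h)
    (A.state ⊗ₖ ketbraZero (S.n s))

theorem acceptedState_kronecker (A : S.Adversary s) : acceptedState A ⊗ₖ ketbraZero (S.n s) =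
    conj (S.zeroW s A.h * (S.zeroW s A.h)ᴴ * (S.comFull s A.h)ᴴ)
      (A.state ⊗ₖ ketbraZero (S.n s)) := by
  rw [acceptedState, conj_conj, conj_kronecker, zeroW_mul_conjTranspose]
  simp only [comFull, conjTranspose_kronecker, conjTranspose_one, ← mul_kronecker_mul,
    Matrix.one_mul]

/-- The challenger's fresh register E plays the role of M', which expresses the experiment through Π
and the encoded swap. -/
theorem trace_mul_responseState (A : S.Adversary s) (b : Bool) (E : Op (S.D s × Qubits A.h)) :
    (E * responseState A b).trace = (S.onDH s E * challengeState A b).trace := by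
  rw [trace_onDH_mul, ← traceFst_traceSnd, responseState, challengeState, acceptedState_kronecker]
  congr 5
  cases b
  · simp only [Bool.false_eq_true, if_false]
    rw [conj_conj, validProj_eq_conj_zeroW, Matrix.mul_assoc, Matrix.mul_assoc, Matrix.mul_assoc]
  · simp only [if_true]
    rw [conj_conj, conj_conj, validProj_eq_conj_zeroW]
    simp only [← Matrix.mul_assoc, swapHat_mul_comFull]

theorem trace_challengeState (A : S.Adversary s) (b : Bool) :
    (challengeState A b).trace = (acceptedState A).trace := by
  have h1 : (acceptedState A).trace = (acceptedState A ⊗ₖ ketbraZero (S.n s)).trace := by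
    rw [trace_kronecker, trace_ketbraZero, mul_one]
  have h2 : (challengeState A false).trace = (acceptedState A).trace := by
    rw [h1, acceptedState_kronecker]
    simp only [challengeState, Bool.false_eq_true, if_false]
    rw [validProj_eq_conj_zeroW, Matrix.mul_assoc, ← conj_conj, trace_conj, comFull_isometry,
      Matrix.one_mul]
  rw [← h2]
  cases b
  · rfl
  · simp only [challengeState, Bool.false_eq_true, if_false, if_true]
    rw [← conj_conj, trace_conj, swapHat_conjTranspose, swapHat_mul_self, Matrix.one_mul]

/-- Both challenge bits are accepted with the same probability, so the contribution of the random
coin cancels. -/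
theorem winProb_eq (A : S.Adversary s) : winProb A = 1 / 2 + 1 / 2 *
    (S.onDH s (A.povm false) * (challengeState A false - challengeState A true)).trace.re := by
  have h1 : A.povm true = 1 - A.povm false := eq_sub_of_add_eq' A.povm_sum
  rw [winProb, outputProb, outputProb, trace_mul_responseState, trace_mul_responseState, h1,
    onDH_sub, onDH_one, Matrix.sub_mul, Matrix.one_mul, trace_sub, Matrix.mul_sub, trace_sub,
    trace_challengeState, Complex.sub_re, Complex.sub_re]
  ring

variable (S s) in
/-- The state of the adversary's registers `(D, H)` when the challenger encodes `M`. -/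
def marginal {h : ℕ} (σ : Op (S.M s × Qubits h)) : Op (S.D s × Qubits h) :=
  traceFst (reindex (Equiv.prodAssoc _ _ _) (Equiv.prodAssoc _ _ _)
    (conj (S.encode s ⊗ₖ (1 : Op (Qubits h))) σ))

theorem trace_marginal {h : ℕ} (σ : Op (S.M s × Qubits h)) :
    (S.marginal s σ).trace = σ.trace := by
  rw [marginal, trace_traceFst, reindex_apply, trace_submatrix_equiv, trace_conj,
    conjTranspose_kronecker, ← mul_kronecker_mul, encode_isometry, conjTranspose_one,
    Matrix.one_mul, one_kronecker_one, Matrix.one_mul]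

theorem trace_onDH_mul_conj_encodeFull {h : ℕ} (E : Op (S.D s × Qubits h))
    (Z : Op ((S.M s × Qubits h) × S.M s)) :
    (S.onDH s E * conj (S.encodeFull s h) Z).trace = (E * S.marginal s (traceSnd Z)).trace := by
  rw [trace_onDH_mul, ← traceFst_traceSnd, encodeFull, traceSnd_conj_kronecker_one, marginal]

theorem conj_swapFull_kronecker {h : ℕ} (σ : Op (S.M s × Qubits h)) :
    traceSnd (conj (S.swapFull s h) (σ ⊗ₖ ketbraZero (S.n s))) =
      ketbraZero (S.n s) ⊗ₖ traceFst σ := by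
  let e : (S.M s × Qubits h) × S.M s ≃ (S.M s × Qubits h) × S.M s :=
    ⟨fun x => ((x.2, x.1.2), x.1.1), fun x => ((x.2, x.1.2), x.1.1), fun _ => rfl, fun _ => rfl⟩
  have h1 : ∀ X : Op ((S.M s × Qubits h) × S.M s), conj (S.swapFull s h) X = X.submatrix e e := by
    intro X
    have h2 : S.swapFull s h = (1 : Op _).submatrix e id := by
      ext ⟨⟨a, b⟩, c⟩ ⟨⟨a', b'⟩, c'⟩
      simp [swapFull, basisMap, e, one_apply, and_comm, and_left_comm, and_assoc]
    rw [conj, h2, conjTranspose_submatrix, conjTranspose_one]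
    have h3 : (1 : Op _).submatrix e id * X = X.submatrix e id := by
      ext i j
      simp [mul_apply, one_apply]
    rw [h3]
    exact mul_basisMap _ _
  rw [h1]
  ext ⟨m, x⟩ ⟨m', x'⟩
  simp [traceSnd, traceFst, e, Finset.mul_sum, mul_comm]

/-- Statistical swap binding bounds the dependence of the marginal on the message. -/
theorem trace_mul_marginal_sub_le {μ : ℝ} (hμ : ∀ A : S.Adversary s, winProb A ≤ 1 / 2 + μ) {h : ℕ}
    {σ : Op (S.M s × Qubits h)} (hσ : IsDensity σ) {E : Op (S.D s × Qubits h)}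
    (hE : E.PosSemidef) (hE' : (1 - E).PosSemidef) :
    (E * (S.marginal s σ - S.marginal s (ketbraZero (S.n s) ⊗ₖ traceFst σ))).trace.re ≤ 2 * μ := by
  -- The adversary submits an honest encoding of σ, which is accepted with certainty, and answers 0
  -- on outcome E. The factor 2 in the bound undoes the 1/2 in `winProb_eq`.
  let A : S.Adversary s :=
    { h := h
      state := conj (S.encode s ⊗ₖ (1 : Op (Qubits h))) σ
      state_isDensity := by
        refine ⟨posSemidef_conj _ hσ.1, ?_⟩
        rw [trace_conj, conjTranspose_kronecker, ← mul_kronecker_mul, encode_isometry,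
          conjTranspose_one, Matrix.one_mul, one_kronecker_one, Matrix.one_mul, hσ.2]
      povm := fun b => if b then 1 - E else E
      povm_posSemidef := by rintro (_ | _) <;> simpa
      povm_sum := by simp }
  have hs : A.state ⊗ₖ ketbraZero (S.n s) = conj (S.encodeFull s h) (σ ⊗ₖ ketbraZero (S.n s)) := by
    simp only [A]
    rw [conj_kronecker, encodeFull]
  have h0 : (S.onDH s E * challengeState A false).trace = (E * S.marginal s σ).trace := by
    simp only [challengeState, Bool.false_eq_true, if_false]
    rw [hs, conj_conj, validProj_eq_encodeFull, Matrix.mul_assoc, encodeFull_isometry,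
      Matrix.mul_one, trace_onDH_mul_conj_encodeFull, traceSnd_kronecker, trace_ketbraZero,
      one_smul]
  have h1 : (S.onDH s E * challengeState A true).trace =
      (E * S.marginal s (ketbraZero (S.n s) ⊗ₖ traceFst σ)).trace := by
    simp only [challengeState, if_true]
    rw [hs, conj_conj, validProj_eq_encodeFull, Matrix.mul_assoc, Matrix.mul_assoc,
      encodeFull_isometry, Matrix.mul_one, swapHat_mul_encodeFull, ← conj_conj,
      trace_onDH_mul_conj_encodeFull, conj_swapFull_kronecker]
  have := hμ A
  rw [winProb_eq] at this
  have hp : A.povm false = E := rfl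
  rw [hp, Matrix.mul_sub, trace_sub, h0, h1] at this
  rw [Matrix.mul_sub, trace_sub]
  linarith

variable {h : ℕ}

/-- An operator with codomain `M × M'`, with `M'` moved to the domain. -/
def slice (χ : Matrix (S.M s × S.M s) (Qubits h) ℂ) : Matrix (S.M s × Qubits h) (S.M s) ℂ :=
  Matrix.of fun x m' => χ (x.1, m') x.2

/-- Translates the hypothesis of the Uhlmann argument into the adversary's view: R is H, and (C,M')
is the discarded register. The transpose comes from `reshape` moving (D,H) into the domain. -/
theorem reshape_encodeCM_mul (χ : Matrix (S.M s × S.M s) (Qubits h) ℂ) :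
    (reshape (S.encodeCM s * χ))ᴴ * reshape (S.encodeCM s * χ) =
      (S.marginal s (slice χ * (slice χ)ᴴ))ᵀ := by
  have key : ∀ c m d r, reshape (S.encodeCM s * χ) (c, m) (d, r) =
      ((S.encode s ⊗ₖ (1 : Op (Qubits h))) * slice χ) ((c, d), r) m := by
    intro c m d r
    simp [reshape, encodeCM, mul_apply, Fintype.sum_prod_type, slice, one_apply]
  have hc : conj (S.encode s ⊗ₖ (1 : Op (Qubits h))) (slice χ * (slice χ)ᴴ) =
      ((S.encode s ⊗ₖ (1 : Op (Qubits h))) * slice χ) *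
        ((S.encode s ⊗ₖ (1 : Op (Qubits h))) * slice χ)ᴴ := by
    rw [conj, conjTranspose_mul]
    simp only [Matrix.mul_assoc]
  ext ⟨d, r⟩ ⟨d', r'⟩
  rw [transpose_apply, marginal, hc, mul_apply, Fintype.sum_prod_type]
  simp only [traceFst, of_apply, reindex_apply, submatrix_apply, Equiv.prodAssoc_symm_apply]
  refine Finset.sum_congr rfl fun c _ => ?_
  rw [mul_apply]
  refine Finset.sum_congr rfl fun m _ => ?_
  rw [conjTranspose_apply, conjTranspose_apply, key, key, mul_comm]

theorem isDensity_slice {χ : Matrix (S.M s × S.M s) (Qubits h) ℂ} (hχ : (χᴴ * χ).trace = 1) :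
    IsDensity (slice χ * (slice χ)ᴴ) := by
  refine ⟨posSemidef_self_mul_conjTranspose _, ?_⟩
  rw [← hχ, trace_mul_comm χᴴ]
  simp only [trace, diag_apply, mul_apply, conjTranspose_apply, Fintype.sum_prod_type, slice,
    of_apply]
  exact Finset.sum_congr rfl fun m _ => Finset.sum_comm

/-- The state on H does not see a swap of M and M' once both are traced out, so the two inputs share
the same |0⟩-encoded comparison state. -/
theorem traceFst_slice_swap (χ : Matrix (S.M s × S.M s) (Qubits h) ℂ) :
    traceFst (slice (S.swapMM s * χ) * (slice (S.swapMM s * χ))ᴴ) =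
      traceFst (slice χ * (slice χ)ᴴ) := by
  have : slice (S.swapMM s * χ) = Matrix.of fun x m' => χ (m', x.1) x.2 := by
    ext x m
    rw [slice, of_apply, ← swapMM_isHermitian, mul_apply]
    simp [swapMM, basisMap, one_apply, apply_ite]
  rw [this]
  ext r r'
  simp only [traceFst, mul_apply, conjTranspose_apply, slice, of_apply]
  exact Finset.sum_comm

theorem exists_approximate_swap {μ : ℝ} (hμ0 : 0 ≤ μ)
    (hμ : ∀ A : S.Adversary s, winProb A ≤ 1 / 2 + μ) :
    ∃ U ∈ unitaryGroup (S.C s × S.M s) ℂ,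
      ‖(U ⊗ₖ (1 : Op (S.D s))) * S.encodeCM s - S.encodeCM s * S.swapMM s‖ ≤ 2 * √(4 * μ) := by
  have hG : (S.encodeCM s * S.swapMM s)ᴴ * (S.encodeCM s * S.swapMM s) = 1 := by
    rw [conjTranspose_mul, Matrix.mul_assoc, ← Matrix.mul_assoc _ (S.encodeCM s),
      encodeCM_isometry, Matrix.one_mul, swapMM_isometry]
  -- A purifying reference of 2n qubits has exactly the dimension of M × M', so it is a legitimate
  -- register H.
  have e : (S.M s × S.M s) ≃ Qubits (S.n s + S.n s) := Fintype.equivOfCardEq (by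
    simp [Fintype.card_prod, pow_add])
  refine exists_unitary_of_marginals_close e (S.encodeCM_isometry s) hG (by positivity) ?_
  intro χ hχ E hE hE'
  have hχ' : ((S.swapMM s * χ)ᴴ * (S.swapMM s * χ)).trace = 1 := by
    rw [conjTranspose_mul, Matrix.mul_assoc, ← Matrix.mul_assoc _ (S.swapMM s),
      swapMM_isometry, Matrix.one_mul, hχ]
  have hET : (1 - Eᵀ).PosSemidef := by
    rw [← transpose_one, ← transpose_sub]
    exact hE'.transpose
  have h1 := trace_mul_marginal_sub_le hμ (isDensity_slice hχ) hE.transpose hET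
  -- Both marginals have trace one, so the complementary effect reverses the one-sided bound. The
  -- two bounds of 2μ add up to 4μ.
  have h2 := trace_mul_marginal_sub_le hμ (isDensity_slice hχ') (E := 1 - Eᵀ) hET
    (by rw [sub_sub_cancel]; exact hE.transpose)
  rw [traceFst_slice_swap, Matrix.sub_mul, Matrix.one_mul, trace_sub, trace_sub, trace_marginal,
    trace_marginal, (isDensity_slice hχ').2, trace_kronecker, trace_ketbraZero, trace_traceFst,
    (isDensity_slice hχ).2, mul_one, sub_self, zero_sub, Complex.neg_re, Matrix.mul_sub,
    trace_sub, Complex.sub_re] at h2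
  rw [Matrix.mul_sub, trace_sub, Complex.sub_re] at h1
  rw [Matrix.mul_assoc, reshape_encodeCM_mul, reshape_encodeCM_mul, ← transpose_sub,
    ← trace_transpose, transpose_mul, transpose_transpose, trace_mul_comm, Matrix.mul_sub,
    trace_sub, Complex.sub_re]
  linarith

/-- A unitary that approximates the encoded swap on the code space extracts the message. -/
theorem traceNorm_extract_le {U : Op (S.C s × S.M s)} (hU : U ∈ unitaryGroup _ ℂ) {κ : ℝ}
    (hκ : ‖(U ⊗ₖ (1 : Op (S.D s))) * S.encodeCM s - S.encodeCM s * S.swapMM s‖ ≤ κ)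
    {ρ : Op ((S.C s × S.D s) × Qubits h)} (hρ : IsDensity ρ) {V : Op (S.D s × Qubits h)}
    (hV : V ∈ unitaryGroup _ ℂ) :
    traceNorm (conj (S.validProj s h) (conj (S.onDH s V)
        (onCM (conjLinear U) (ρ ⊗ₖ ketbraZero (S.n s)))) -
      conj (S.swapHat s h) (conj (S.validProj s h) (conj (S.onDH s V)
        (ρ ⊗ₖ ketbraZero (S.n s))))) ≤ 2 * κ := by
  set Y := place (S.regroup s h) U
  have hY : Y ∈ unitaryGroup _ ℂ := place_mem_unitaryGroup _ hU
  have hYY : Yᴴ * Y = 1 := mem_unitaryGroup_iff'.1 hY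
  set Q := S.validProj s h with hQ
  set T := S.swapHat s h with hT
  have hd : IsDensity (conj (S.onDH s V) (ρ ⊗ₖ ketbraZero (S.n s))) := by
    refine ⟨posSemidef_conj _ (hρ.1.kronecker (posSemidef_ketbraZero _)), ?_⟩
    rw [trace_conj, onDH_conjTranspose, onDH_mul, show Vᴴ * V = 1 from mem_unitaryGroup_iff'.1 hV,
      onDH_one, Matrix.one_mul, trace_kronecker, hρ.2, trace_ketbraZero, one_mul]
  rw [onCM_conjLinear, conj_conj (S.onDH s V), ← place_mul_onDH, ← conj_conj Y, conj_conj Q,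
    conj_conj T]
  have hTn : ‖T‖ ≤ 1 := norm_le_one_of_mem_unitaryGroup (S.swapHat_mem_unitaryGroup s h)
  have hYn : ‖Y‖ ≤ 1 := norm_le_one_of_mem_unitaryGroup hY
  have hQn : ‖Q‖ ≤ 1 := S.norm_validProj_le s h
  have hFn : ‖S.encodeCM s‖ ≤ 1 := by
    apply norm_le_one_of_posSemidef
    rw [encodeCM_isometry, sub_self]
    exact PosSemidef.zero
  have h1 : ‖(Y - T) * Q‖ ≤ κ := by
    have : (Y - T) * Q = place (S.regroupH s h) (((U ⊗ₖ (1 : Op (S.D s))) * S.encodeCM s -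
        S.encodeCM s * S.swapMM s) * (S.encodeCM s)ᴴ) := by
      rw [Matrix.sub_mul, hT, hQ, swapHat_mul_validProj, validProj_eq_place, Matrix.sub_mul,
        ← place_sub, Matrix.mul_assoc (U ⊗ₖ (1 : Op (S.D s))), ← place_mul, ← place_regroup]
    rw [this]
    refine (norm_place_le _ _).trans ((l2_opNorm_mul _ _).trans ?_)
    rw [l2_opNorm_conjTranspose]
    have := norm_nonneg ((U ⊗ₖ (1 : Op (S.D s))) * S.encodeCM s - S.encodeCM s * S.swapMM s)
    nlinarith
  -- The closeness of Y and T is known with Q on the right but needed with Q on the left. Taking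
  -- adjoints, with T² = 1, TQ = QT and Y unitary, exchanges the two.
  have h2 : (Q * Y - T * Q)ᴴ = -(Yᴴ * ((Y - T) * Q) * T) := by
    rw [conjTranspose_sub, conjTranspose_mul, conjTranspose_mul, hQ, hT, validProj_conjTranspose,
      swapHat_conjTranspose, Matrix.mul_assoc, Matrix.mul_assoc (Y - S.swapHat s h),
      validProj_mul_swapHat, Matrix.sub_mul, ← Matrix.mul_assoc (S.swapHat s h),
      swapHat_mul_self, Matrix.one_mul, Matrix.mul_sub, ← Matrix.mul_assoc Yᴴ Y, hYY,
      Matrix.one_mul, neg_sub]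
  have h3 : ‖Q * Y - T * Q‖ ≤ κ := by
    rw [← l2_opNorm_conjTranspose, h2, norm_neg]
    have hYn' : ‖Yᴴ‖ ≤ 1 := by rw [l2_opNorm_conjTranspose]; exact hYn
    calc ‖Yᴴ * ((Y - T) * Q) * T‖ ≤ ‖Yᴴ‖ * ‖(Y - T) * Q‖ * ‖T‖ :=
          (norm_mul_le _ _).trans (by gcongr; exact norm_mul_le _ _)
      _ ≤ 1 * κ * 1 := by
          have : 0 ≤ κ := (norm_nonneg _).trans h1
          gcongr
      _ = κ := by ring
  refine (traceNorm_conj_sub_conj_le ?_ ?_ hd).trans (by linarith)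
  · exact (norm_mul_le _ _).trans (mul_le_one₀ hQn (norm_nonneg _) hYn)
  · exact (norm_mul_le _ _).trans (mul_le_one₀ hTn (norm_nonneg _) hQn)

theorem negligible_sqrt_abs {μ : ℕ → ℝ} (hμ : Negligible μ) (c : ℝ) :
    Negligible fun s => c * √|μ s| := by
  intro k
  -- Uses sᵏ√|μ| = √(s²ᵏ|μ|).
  have h1 := (hμ (2 * k)).abs.sqrt.const_mul c
  simp only [abs_zero, Real.sqrt_zero, mul_zero] at h1
  refine h1.congr fun s => ?_
  rw [abs_mul, abs_of_nonneg (by positivity : (0 : ℝ) ≤ (s : ℝ) ^ (2 * k)),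
    Real.sqrt_mul (by positivity), mul_comm 2 k, pow_mul, Real.sqrt_sq (by positivity)]
  ring

variable (S s) in
/-- The adversary that sends `|0⟩` and answers `0`. -/
def trivialAdversary : S.Adversary s where
  h := 0
  state := Matrix.single ((fun _ => false, fun _ => false), fun _ => false)
    ((fun _ => false, fun _ => false), fun _ => false) 1
  state_isDensity := by
    refine ⟨?_, by simp⟩
    rw [← diagonal_single]
    exact PosSemidef.diagonal (Pi.single_nonneg.2 zero_le_one)
  povm b := if b then 0 else 1
  povm_posSemidef := by rintro (_ | _) <;> simp [PosSemidef.one, PosSemidef.zero]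
  povm_sum := by simp

theorem StatisticallySwapBinding.statisticallyExtractable (hS : S.StatisticallySwapBinding) :
    S.StatisticallyExtractable := by
  obtain ⟨μ, hμ, hA⟩ := hS
  have hA' : ∀ s, ∀ A : S.Adversary s, winProb A ≤ 1 / 2 + |μ s| := by
    intro s A
    -- Binding quantifies over families of adversaries; a single adversary at s is completed to a
    -- family by trivial ones.
    have := hA (Function.update (fun s => S.trivialAdversary s) s A) s
    rw [Function.update_self] at this
    linarith [le_abs_self (μ s)]
  choose U hU hUn using fun s => exists_approximate_swap (abs_nonneg (μ s)) (hA' s)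
  -- The constant is 8√|μ| = 2 · 2√(4|μ|).
  refine ⟨fun s => conjLinear (U s), fun s => isCPTP_conjLinear (hU s), _,
    negligible_sqrt_abs hμ 8, fun s h ρ V hρ hV => ?_⟩
  refine (traceNorm_extract_le (hU s) (hUn s) hρ hV).trans (le_of_eq ?_)
  rw [Real.sqrt_mul (by norm_num), show (4 : ℝ) = 2 ^ 2 by norm_num,
    Real.sqrt_sq (by norm_num)]
  ring

end QSC

end QuantumCommitment

/-! ### Extractability implies swap binding. -/

namespace QuantumCommitment

open Matrix

section

variable {α β γ : Type} [Fintype α] [DecidableEq α] [Fintype β] [DecidableEq β] [Fintype γ]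
  [DecidableEq γ]

/-- Cauchy–Schwarz for the semi-inner product tr(XᴴYω), by the discriminant of t ↦ ‖tX − Y‖². -/
theorem re_trace_conjTranspose_mul_le (X Y : Op α) {ω : Op α} (hω : ω.PosSemidef) :
    (Xᴴ * Y * ω).trace.re ≤ √((Xᴴ * X * ω).trace.re * (Yᴴ * Y * ω).trace.re) := by
  have hc : (Yᴴ * X * ω).trace.re = (Xᴴ * Y * ω).trace.re := by
    have : (Yᴴ * X * ω).trace = star (Xᴴ * Y * ω).trace := by
      rw [← trace_conjTranspose, conjTranspose_mul, conjTranspose_mul, conjTranspose_conjTranspose,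
        hω.isHermitian.eq, trace_mul_comm]
    rw [this]
    rfl
  have hq : ∀ t : ℝ, 0 ≤ (Xᴴ * X * ω).trace.re * (t * t) + (-2 * (Xᴴ * Y * ω).trace.re) * t +
      (Yᴴ * Y * ω).trace.re := by
    intro t
    have h := (Complex.le_def.1 ((posSemidef_conjTranspose_mul_self
      ((t : ℂ) • X - Y)).trace_mul_nonneg hω)).1
    have e : ((((t : ℂ) • X - Y)ᴴ * ((t : ℂ) • X - Y)) * ω).trace.re =
        (Xᴴ * X * ω).trace.re * (t * t) + (-2 * (Xᴴ * Y * ω).trace.re) * t +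
          (Yᴴ * Y * ω).trace.re := by
      rw [conjTranspose_sub, conjTranspose_smul]
      simp only [Matrix.sub_mul, Matrix.mul_sub, smul_mul, Matrix.mul_smul, trace_sub, trace_smul,
        Complex.sub_re, Complex.star_def, Complex.conj_ofReal, smul_eq_mul, Complex.re_ofReal_mul,
        hc]
      ring
    rwa [e] at h
  have hd := discrim_le_zero hq
  rw [discrim] at hd
  exact Real.le_sqrt_of_sq_le (by nlinarith)

theorem re_trace_mul_le_one {Z ω : Op α} (hZ : ‖Z‖ ≤ 1) (hω : IsDensity ω) :
    (Z * ω).trace.re ≤ 1 := by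
  have h := norm_trace_mul_le Z hω.1
  rw [hω.2, Complex.one_re, mul_one] at h
  exact (Complex.re_le_norm _).trans (h.trans hZ)

/-- The gentle measurement lemma. -/
theorem re_trace_mul_sub_conj_le {E Q ω : Op α} (hE : E.IsHermitian) (hE1 : ‖E‖ ≤ 1)
    (hQ : Qᴴ = Q) (hQQ : Q * Q = Q) (hω : IsDensity ω) {ε : ℝ}
    (hε : 1 - ε ≤ (conj Q ω).trace.re) :
    (E * ω).trace.re - (E * conj Q ω).trace.re ≤ 2 * √ε := by
  have hQ1 : ‖Q‖ ≤ 1 := by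
    have := l2_opNorm_conjTranspose_mul_self Q
    rw [hQ, hQQ] at this
    nlinarith [norm_nonneg Q]
  have hq : (1 - Q)ᴴ = 1 - Q := by rw [conjTranspose_sub, conjTranspose_one, hQ]
  have hb : ((1 - Q)ᴴ * (1 - Q) * ω).trace.re ≤ ε := by
    rw [trace_conj, hQ, hQQ] at hε
    have : (1 - Q) * (1 - Q) = 1 - Q := by
      rw [Matrix.mul_sub, Matrix.sub_mul, Matrix.sub_mul, hQQ]
      simp
    rw [hq, this, Matrix.sub_mul, Matrix.one_mul, trace_sub, hω.2, Complex.sub_re, Complex.one_re]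
    linarith
  have hb0 : 0 ≤ ((1 - Q)ᴴ * (1 - Q) * ω).trace.re :=
    (Complex.le_def.1 ((posSemidef_conjTranspose_mul_self (1 - Q)).trace_mul_nonneg hω.1)).1
  have h1 := re_trace_conjTranspose_mul_le E (1 - Q) hω.1
  have h2 := re_trace_conjTranspose_mul_le (1 - Q) (E * Q) hω.1
  have n1 : (Eᴴ * E * ω).trace.re ≤ 1 := by
    refine re_trace_mul_le_one ?_ hω
    rw [l2_opNorm_conjTranspose_mul_self]
    exact mul_le_one₀ hE1 (norm_nonneg _) hE1
  have n2 : ((E * Q)ᴴ * (E * Q) * ω).trace.re ≤ 1 := by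
    refine re_trace_mul_le_one ?_ hω
    have : ‖E * Q‖ ≤ 1 := (norm_mul_le _ _).trans (mul_le_one₀ hE1 (norm_nonneg _) hQ1)
    rw [l2_opNorm_conjTranspose_mul_self]
    exact mul_le_one₀ this (norm_nonneg _) this
  have s1 := h1.trans (Real.sqrt_le_sqrt (y := ε) (by nlinarith))
  have s2 := h2.trans (Real.sqrt_le_sqrt (y := ε) (by nlinarith))
  -- Each term contains one factor 1 − Q, whose weight in ω is at most ε, so Cauchy–Schwarz bounds
  -- it by √ε.
  have e : (E * ω).trace - (E * conj Q ω).trace =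
      (Eᴴ * (1 - Q) * ω).trace + ((1 - Q)ᴴ * (E * Q) * ω).trace := by
    have : (E * (Q * ω * Q)).trace = (Q * (E * (Q * ω))).trace := by
      rw [← Matrix.mul_assoc, trace_mul_comm]
    rw [hE.eq, hq, conj, hQ, this]
    simp only [Matrix.mul_sub, Matrix.sub_mul, trace_sub, Matrix.mul_one, Matrix.one_mul,
      Matrix.mul_assoc]
    ring
  have e' := congrArg Complex.re e
  rw [Complex.sub_re, Complex.add_re] at e'
  linarith

theorem IsCPTP.posSemidef_ampliate {Φ : Op α →ₗ[ℂ] Op β} (hΦ : IsCPTP Φ) {ρ : Op (α × γ)}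
    (hρ : ρ.PosSemidef) : (ampliate Φ γ ρ).PosSemidef := by
  let e := Fintype.equivFin γ
  have h := hΦ.completelyPositive (Fintype.card γ)
    (ρ.submatrix (Prod.map id e.symm) (Prod.map id e.symm)) (hρ.submatrix _)
  convert h.submatrix (Prod.map id e) using 1
  ext ⟨i, x⟩ ⟨j, y⟩
  simp [ampliate]

theorem IsCPTP.traceFst_ampliate {Φ : Op α →ₗ[ℂ] Op β} (hΦ : IsCPTP Φ) (ρ : Op (α × γ)) :
    traceFst (ampliate Φ γ ρ) = traceFst ρ := by
  ext x y
  exact hΦ.tracePreserving (Matrix.of fun i j => ρ (i, x) (j, y))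

end

namespace QSC

variable {S : QSC} {s : ℕ}

theorem posSemidef_onCM {Ext : Op (S.C s × S.M s) →ₗ[ℂ] Op (S.C s × S.M s)} (hExt : IsCPTP Ext)
    {h : ℕ} {ρ : Op (((S.C s × S.D s) × Qubits h) × S.M s)} (hρ : ρ.PosSemidef) :
    (onCM Ext ρ).PosSemidef :=
  (hExt.posSemidef_ampliate (hρ.submatrix _)).submatrix _

/-- No signalling: trace preservation on (C,M') fixes the marginal on (D,H). -/
theorem trace_onDH_mul_onCM {Ext : Op (S.C s × S.M s) →ₗ[ℂ] Op (S.C s × S.M s)}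
    (hExt : IsCPTP Ext) {h : ℕ} (E : Op (S.D s × Qubits h))
    (ρ : Op (((S.C s × S.D s) × Qubits h) × S.M s)) :
    (S.onDH s E * onCM Ext ρ).trace = (S.onDH s E * ρ).trace := by
  rw [trace_onDH_mul, trace_onDH_mul, onCM]
  congr 2
  simp only [reindex_apply, Equiv.symm_symm, submatrix_submatrix, Equiv.self_comp_symm,
    submatrix_id_id]
  exact hExt.traceFst_ampliate _

theorem norm_le_one_of_posSemidef_sub {ι : Type} [Fintype ι] [DecidableEq ι] {E : Op ι}
    (hE : E.PosSemidef) (hE' : (1 - E).PosSemidef) : ‖E‖ ≤ 1 :=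
  (CStarAlgebra.norm_le_one_iff_of_nonneg E hE.nonneg).2 hE'

/-- For the normalized accepted state, a measurement on (D,H) loses nothing under Ext, then 2√ε
under Π by gentle measurement, then ε in passing to the swapped state; `winProb_eq` halves the sum.
-/
theorem winProb_le_of_extract {Ext : Op (S.C s × S.M s) →ₗ[ℂ] Op (S.C s × S.M s)}
    (hExt : IsCPTP Ext) {ε : ℝ} (hε : 0 ≤ ε)
    (hex : ∀ (h : ℕ) (ρ : Op ((S.C s × S.D s) × Qubits h)), IsDensity ρ →
      traceNorm (conj (S.validProj s h) (onCM Ext (ρ ⊗ₖ ketbraZero (S.n s))) -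
        conj (S.swapHat s h) (conj (S.validProj s h) (ρ ⊗ₖ ketbraZero (S.n s)))) ≤ ε)
    (A : S.Adversary s) : winProb A ≤ 1 / 2 + (√ε + 1 / 2 * ε) := by
  set Q := S.validProj s A.h with hQdef
  set T := S.swapHat s A.h with hTdef
  set E := S.onDH s (A.povm false) with hEdef
  have hQ : Qᴴ = Q := S.validProj_conjTranspose s A.h
  have hQQ : Q * Q = Q := S.validProj_mul_self s A.h
  have hpovm : (1 - A.povm false).PosSemidef := by
    rw [← eq_sub_of_add_eq' A.povm_sum]
    exact A.povm_posSemidef true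
  have hE : E.PosSemidef := posSemidef_onDH (A.povm_posSemidef false)
  have hE' : ‖E‖ ≤ 1 := norm_le_one_of_posSemidef_sub hE (by
    rw [hEdef, ← onDH_one, ← onDH_sub]
    exact posSemidef_onDH hpovm)
  set τ : Op ((S.C s × S.D s) × Qubits A.h) := conj (conj (S.com s)
    ((1 : Op (S.M s)) ⊗ₖ ketbraZero s) ⊗ₖ (1 : Op (Qubits A.h))) A.state with hτdef
  have hτ : τ.PosSemidef := posSemidef_conj _ A.state_isDensity.1
  have h0 : challengeState A false = τ ⊗ₖ ketbraZero (S.n s) := by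
    rw [hτdef, conj_kronecker]
    rfl
  have h1 : challengeState A true = conj T (τ ⊗ₖ ketbraZero (S.n s)) := by
    rw [← h0]
    simp only [challengeState, if_true, Bool.false_eq_true, if_false]
    rw [conj_conj]
  have hQτ : conj Q (τ ⊗ₖ ketbraZero (S.n s)) = τ ⊗ₖ ketbraZero (S.n s) := by
    rw [← h0]
    simp only [challengeState, Bool.false_eq_true, if_false]
    rw [conj_conj, hQQ]
  have hρ0 : IsDensity (A.state ⊗ₖ ketbraZero (S.n s)) :=
    ⟨A.state_isDensity.1.kronecker (posSemidef_ketbraZero _), by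
      rw [trace_kronecker, A.state_isDensity.2, trace_ketbraZero, one_mul]⟩
  set p := τ.trace.re with hp
  have hτt : τ.trace = (p : ℂ) := by
    have := Complex.le_def.1 hτ.trace_nonneg
    exact Complex.ext rfl (by simpa using this.2.symm)
  have hp0 : 0 ≤ p := (Complex.le_def.1 hτ.trace_nonneg).1
  have hp1 : p ≤ 1 := by
    have e : (challengeState A false).trace.re = p := by
      rw [h0, trace_kronecker, trace_ketbraZero, mul_one]
    rw [← e]
    simp only [challengeState, Bool.false_eq_true, if_false]
    rw [trace_conj]
    change (Qᴴ * Q * _).trace.re ≤ 1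
    rw [hQ, hQQ]
    exact re_trace_mul_le_one (S.norm_validProj_le s A.h) hρ0
  rw [winProb_eq]
  -- If acceptance never occurs there is no state to normalize, and the advantage vanishes.
  rcases eq_or_ne p 0 with hpz | hpz
  · have : τ = 0 := hτ.trace_eq_zero_iff.1 (by rw [hτt, hpz, Complex.ofReal_zero])
    rw [h0, h1, this]
    simp only [zero_kronecker, conj, Matrix.zero_mul, sub_self, trace_zero,
      Complex.zero_re, mul_zero, add_zero]
    have := Real.sqrt_nonneg ε
    linarith
  set ρ : Op ((S.C s × S.D s) × Qubits A.h) := ((p⁻¹ : ℝ) : ℂ) • τ with hρdef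
  have hρ : IsDensity ρ := by
    refine ⟨hτ.smul (by simpa using hp0), ?_⟩
    rw [hρdef, trace_smul, hτt, smul_eq_mul, ← Complex.ofReal_mul, inv_mul_cancel₀ hpz,
      Complex.ofReal_one]
  set ρ' := ρ ⊗ₖ ketbraZero (S.n s) with hρ'
  have hτρ : τ ⊗ₖ ketbraZero (S.n s) = (p : ℂ) • ρ' := by
    rw [hρ', ← smul_kronecker, hρdef, smul_smul, ← Complex.ofReal_mul, mul_inv_cancel₀ hpz,
      Complex.ofReal_one, one_smul]
  have hp' : (p : ℂ) ≠ 0 := by exact_mod_cast hpz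
  have conj_smul : ∀ B X : Op (((S.C s × S.D s) × Qubits A.h) × S.M s),
      conj B ((p : ℂ) • X) = (p : ℂ) • conj B X := by
    intro B X
    simp only [conj, Matrix.mul_smul, smul_mul]
  have hQρ : conj Q ρ' = ρ' := by
    rw [hτρ, conj_smul] at hQτ
    exact smul_right_injective _ hp' hQτ
  have hbound := hex A.h ρ hρ
  rw [← hρ', ← hQdef, hQρ] at hbound
  set ω := onCM Ext ρ' with hω
  have hρ'd : IsDensity ρ' := ⟨hρ.1.kronecker (posSemidef_ketbraZero _), by
    rw [hρ', trace_kronecker, hρ.2, trace_ketbraZero, one_mul]⟩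
  have hωE : ∀ B : Op (S.D s × Qubits A.h),
      (S.onDH s B * ω).trace = (S.onDH s B * ρ').trace := fun B => trace_onDH_mul_onCM hExt B ρ'
  have hωd : IsDensity ω := by
    refine ⟨posSemidef_onCM hExt hρ'd.1, ?_⟩
    have := hωE 1
    rwa [onDH_one, Matrix.one_mul, Matrix.one_mul, hρ'd.2] at this
  have hn : ∀ Z : Op (((S.C s × S.D s) × Qubits A.h) × S.M s), ‖Z‖ ≤ 1 →
      |(Z * (conj Q ω - conj T ρ')).trace.re| ≤ ε := by
    intro Z hZ
    refine (Complex.abs_re_le_norm _).trans ((norm_trace_mul_le_traceNorm _ _).trans ?_)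
    have := traceNorm_nonneg (conj Q ω - conj T ρ')
    nlinarith [norm_nonneg Z]
  have hTρ : (conj T ρ').trace = 1 := by
    rw [trace_conj, hTdef, swapHat_conjTranspose, swapHat_mul_self, Matrix.one_mul, hρ'd.2]
  have hgentle : 1 - ε ≤ (conj Q ω).trace.re := by
    -- Testing with Z = 1 compares traces: the swapped state has trace one, so Π accepts the
    -- extracted state with probability at least 1 − ε.
    have := hn 1 (norm_le_one_of_posSemidef_sub PosSemidef.one (by simp [PosSemidef.zero]))
    rw [Matrix.one_mul, trace_sub, hTρ, Complex.sub_re, Complex.one_re] at this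
    linarith [neg_abs_le ((conj Q ω).trace.re - 1)]
  have hg := re_trace_mul_sub_conj_le hE.isHermitian hE' hQ hQQ hωd hgentle
  have hd := le_of_abs_le (hn E hE')
  rw [hωE, Matrix.mul_sub, trace_sub, Complex.sub_re] at *
  have hfin : (E * (challengeState A false - challengeState A true)).trace.re =
      p * ((E * ρ').trace.re - (E * conj T ρ').trace.re) := by
    rw [h0, h1, hτρ, conj_smul, ← smul_sub, Matrix.mul_smul, trace_smul, smul_eq_mul,
      Complex.re_ofReal_mul, Matrix.mul_sub, trace_sub, Complex.sub_re]
  rw [Matrix.mul_sub, trace_sub, Complex.sub_re] at hfin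
  rw [hfin]
  have hs := Real.sqrt_nonneg ε
  have : p * ((E * ρ').trace.re - (E * conj T ρ').trace.re) ≤ 2 * √ε + ε := by
    nlinarith
  linarith

theorem StatisticallyExtractable.statisticallySwapBinding (hS : S.StatisticallyExtractable) :
    S.StatisticallySwapBinding := by
  obtain ⟨Ext, hExt, μ, hμ, hex⟩ := hS
  have habs : Negligible fun s => |μ s| := hμ.trans_abs_le fun s => (abs_abs (μ s)).le
  refine ⟨fun s => 1 * √|μ s| + 1 / 2 * |μ s|,
    (negligible_sqrt_abs hμ 1).add (habs.const_mul _), fun A s => ?_⟩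
  simp only [one_mul]
  refine winProb_le_of_extract (hExt s) (abs_nonneg _) (fun h ρ hρ => ?_) (A s)
  -- Only the identity on (D,H) is needed in this direction.
  have := hex s h ρ 1 hρ (one_mem _)
  rw [onDH_one] at this
  have h1 : ∀ X : Op (((S.C s × S.D s) × Qubits h) × S.M s), conj 1 X = X := by
    intro X
    rw [conj, conjTranspose_one, Matrix.one_mul, Matrix.mul_one]
  rw [h1, h1] at this
  exact this.trans (le_abs_self _)

end QSC

end QuantumCommitment

end

theorem mainTheorem11 (S : QuantumCommitment.QSC) :
    S.StatisticallySwapBinding ↔ S.StatisticallyExtractable :=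
  ⟨fun h => h.statisticallyExtractable, fun h => h.statisticallySwapBinding⟩
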